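/- Let $n\ge 2$ and let $G\simeq C_2\oplus C_2\oplus C_{2n}$, so that $\exp(G)=2n$. A sequence over $G$ is a finite multiset of elements of $G$ (equivalently, an element of the free abelian monoid over $G$, written multiplicatively); its length $|S|$ is the number of terms counted with multiplicity, and it is zero-sum if its terms add up to $0$. A sequence is called short if it is nonempty and has length at most $\exp(G)$. Let $\mathsf{s}(G)$ (respectively $\eta(G)$) be the smallest nonnegative integer $\ell$ such that every sequence over $G$ of length at least $\ell$ has a zero-sum subsequence of length $\exp(G)$ (respectively, a short zero-sum subsequence). For $h\in G$, let $h+S$ denote the sequence obtained by adding $h$ to each term of $S$. For every sequence $S$ over $G$ of length $|S|=\mathsf{s}(G)-1$ that has no zero-sum subsequence of length $\exp(G)$, there exist $f\in G$ and sequences $C,T$ over $G$ such that $-f+S=CT$, where $T$ has length $|T|=\eta(G)-1$ and has no short zero-sum subsequence, and $C$ has length $|C|=\exp(G)-1=2n-1$ and is of the form $$C=0^{2u+1}f_1^{2v}f_2^{2w}$$ with nonnegative integers $u,v,w$ and elements $f_1,f_2\in G$ with $\operatorname{ord}(f_1)=\operatorname{ord}(f_2)=2$. -/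

import Mathlib

/-! Sequences over `G` (elements of the free abelian monoid over `G`, written multiplicatively
in the literature) are multisets `S : Multiset G`: the length is `Multiset.card S`, the sum is
`Multiset.sum S`, subsequences are sub-multisets `T ≤ S`, and the product of sequences is `+`. -/

namespace ZeroSum

/-- `Σ_L(S)`: the set of sums of the nonempty subsequences of `S` with length in `L`. -/
def subsums {G : Type*} [AddCommGroup G] (L : Set ℕ) (S : Multiset G) : Set G :=
  {g | ∃ T : Multiset G, T ≤ S ∧ T ≠ 0 ∧ Multiset.card T ∈ L ∧ T.sum = g}

/-- `s_L(G)`: the smallest `ℓ : ℕ` such that each sequence over `G` of length at least `ℓ` has a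
nonempty zero-sum subsequence with length in `L`; it is `⊤` if there is no such `ℓ`. -/
noncomputable def sConst (G : Type*) [AddCommGroup G] (L : Set ℕ) : ℕ∞ :=
  ⨅ ℓ ∈ {ℓ : ℕ | ∀ S : Multiset G, ℓ ≤ Multiset.card S → (0 : G) ∈ subsums L S}, (ℓ : ℕ∞)

/-- The Erdős–Ginzburg–Ziv constant `s(G)`. -/
noncomputable def egzConst (G : Type*) [AddCommGroup G] : ℕ∞ :=
  sConst G {AddMonoid.exponent G}

/-- The `η`-constant `η(G)`. -/
noncomputable def etaConst (G : Type*) [AddCommGroup G] : ℕ∞ :=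
  sConst G (Set.Icc 1 (AddMonoid.exponent G))

/-- `f + S`: every term of `S` is translated by `f`. -/
def translate {G : Type*} [AddCommGroup G] (f : G) (S : Multiset G) : Multiset G :=
  S.map (fun g => f + g)

/-- `S` has a short zero-sum subsequence: nonempty, of length at most `exp(G)`, with sum `0`. -/
def HasShortZeroSumSubsequence {G : Type*} [AddCommGroup G] (S : Multiset G) : Prop :=
  ∃ T : Multiset G, T ≤ S ∧ T ≠ 0 ∧ Multiset.card T ≤ AddMonoid.exponent G ∧ T.sum = 0

/-- `S` has a zero-sum subsequence of length `exp(G)`. -/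
def HasZeroSumSubsequenceOfLengthExp {G : Type*} [AddCommGroup G] (S : Multiset G) : Prop :=
  ∃ T : Multiset G, T ≤ S ∧ Multiset.card T = AddMonoid.exponent G ∧ T.sum = 0

end ZeroSum

namespace ZeroSum

open Multiset

/-! Reduction modulo `2 • G` maps G onto C_2^3, and its kernel ⟨e⟩ is cyclic of order n. Two terms
of equal class have their sum in ⟨e⟩. If S has no zero-sum subsequence of length 2n, then sums of
disjoint such pairs have none of length n, so by Erdős–Ginzburg–Ziv there are at most 2n-2 pairs. An
explicit example shows |S| ≥ 4n+2. Pairing up 4n+2 terms as far as possible leaves 6 or 8 terms of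
distinct classes.

The engine is `inverseEGZ`: an extremal sequence of length 2n-2 over C_n is g^(n-1) h^(n-1). It is
proved by Cauchy–Davenport for primes and is multiplicative in n. Consequently 2n-3 elements have at
most one extremal completion (`eq_of_zeroSumFreeAt_cons`). A quadruple with sum in ⟨e⟩ also
determines a completion, by passing to complements (`zeroSumFreeAt_cons_of_quad`). Thus exchanging
terms between pairs and leftovers yields many linear equations.

With 8 leftovers these equations are contradictory (`false_of_card_eq_eight`). With 6 they show that
every pair is {r, r} for a leftover r, and that the leftovers form three couples whose doubles add
up to g + h (`exists_couples_of_card_eq_six`). As g ≠ h, each couple has at most one member with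
double g. The n-1 pairs with sum g therefore take at most three values; with one more leftover f of
double g they give the 2n-1 terms of C (`exists_replicate_le`).

After translation by -f, the sequence C has zero-sum subsequences of every length up to 2n-1, so a
short zero-sum subsequence of T would extend to one of length 2n. Padding with zeros bounds η(G)
from above and fixes the length of T. -/

theorem exists_le_map_eq {α β : Type*} (f : α → β) (s : Multiset α) {t : Multiset β}
    (h : t ≤ s.map f) : ∃ u ≤ s, u.map f = t := by
  classical
  induction s using Multiset.induction_on generalizing t with
  | empty => exact ⟨0, le_rfl, by simpa [eq_comm] using h⟩
  | cons a s ih =>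
    rw [map_cons] at h
    by_cases ha : f a ∈ t
    · obtain ⟨t', rfl⟩ := exists_cons_of_mem ha
      obtain ⟨u, hu, rfl⟩ := ih ((cons_le_cons_iff _).1 h)
      exact ⟨a ::ₘ u, cons_le_cons a hu, by simp⟩
    · obtain ⟨u, hu, rfl⟩ := ih ((le_cons_of_notMem ha).1 h)
      exact ⟨u, hu.trans (le_cons_self s a), rfl⟩

theorem exists_le_card {α : Type*} (s : Multiset α) {k : ℕ} (h : k ≤ card s) :
    ∃ u ≤ s, card u = k := by
  obtain ⟨u, hu, h'⟩ := exists_le_map_eq (fun _ => ()) s (t := replicate k ())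
    (by rw [map_const']; exact (replicate_le_replicate _).2 h)
  exact ⟨u, hu, by simpa using congrArg card h'⟩

theorem exists_add_of_le_add {α : Type*} {s t u : Multiset α} (h : s ≤ t + u) :
    ∃ t' ≤ t, ∃ u' ≤ u, s = t' + u' := by
  classical
  refine ⟨s ∩ t, inter_le_right, s - t, ?_, ?_⟩
  · rw [Multiset.sub_le_iff_le_add']
    exact h
  · rw [add_comm, sub_add_inter]

theorem join_le_join {α : Type*} {B C : Multiset (Multiset α)} (h : B ≤ C) : B.join ≤ C.join := by
  obtain ⟨D, rfl⟩ := Multiset.le_iff_exists_add.1 h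
  rw [join_add]
  exact le_add_right _ _

/-- `S` has no zero-sum subsequence of length `k`. -/
def ZeroSumFreeAt {G : Type*} [AddCommGroup G] (k : ℕ) (S : Multiset G) : Prop :=
  ∀ T ≤ S, card T = k → T.sum ≠ 0

/-! ### Pairs of distinct elements and their sumsets modulo a prime -/

section

variable {G : Type*} [AddCommGroup G]

theorem ZeroSumFreeAt.mono {k : ℕ} {S S' : Multiset G} (h : ZeroSumFreeAt k S) (hS : S' ≤ S) :
    ZeroSumFreeAt k S' :=
  fun T hT => h T (hT.trans hS)

/-- A sequence of length `2 * k` in which no element occurs more than `k` times splits into `k`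
pairs of distinct elements. -/
theorem exists_pairs_ne {α : Type*} [DecidableEq α] (k : ℕ) (S : Multiset α)
    (hS : card S = 2 * k) (hc : ∀ x, count x S ≤ k) :
    ∃ L : Multiset (α × α), card L = k ∧ (∀ q ∈ L, q.1 ≠ q.2) ∧
      S = L.map Prod.fst + L.map Prod.snd := by
  induction k generalizing S with
  | zero => exact ⟨0, by simp, by simp, by simpa using hS⟩
  | succ k ih =>
    have hne : S.toFinset.Nonempty := by
      rw [toFinset_nonempty]; rintro rfl; simp at hS
    obtain ⟨x, hx, hmax⟩ := Finset.exists_max_image S.toFinset (fun y => count y S) hne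
    rw [mem_toFinset] at hx
    have hy : ∃ y ∈ S, y ≠ x := by
      by_contra! hall
      have := eq_replicate_card.2 hall
      have h2 : count x S = card S := by rw [this]; simp
      have := hc x
      omega
    obtain ⟨y, hyS, hyx⟩ := hy
    obtain ⟨S₁, rfl⟩ := exists_cons_of_mem hx
    obtain ⟨S₂, rfl⟩ := exists_cons_of_mem ((mem_cons.1 hyS).resolve_left hyx)
    have hcard : card S₂ = 2 * k := by simp at hS; omega
    have hc2 : ∀ z, count z S₂ ≤ k := by
      intro z
      have h1 := hc z
      by_cases hzx : z = x
      · subst hzx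
        rw [count_cons_self] at h1
        have := count_le_count_cons z y S₂
        omega
      · by_cases hzy : z = y
        · subst hzy
          rw [count_cons_of_ne hzx, count_cons_self] at h1
          omega
        -- A third value z was at most as frequent as x, so its count in `S₂` exceeds that of x by
        -- at most one. Both counts together are at most 2k, hence that of z is at most k.
        · by_cases hz : z ∈ S₂
          · have h3 := hmax z (by simp [hz])
            rw [count_cons_of_ne hzx, count_cons_of_ne hzy, count_cons_self,
              count_cons_of_ne hyx.symm] at h3
            have h4 : count z S₂ + count x S₂ ≤ card S₂ := by
              have h5 : replicate (count z S₂) z + replicate (count x S₂) x ≤ S₂ := by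
                rw [Multiset.le_iff_count]
                intro w
                rw [count_add, count_replicate, count_replicate]
                split_ifs with h6 h7 h7
                · exact absurd (h6.trans h7.symm) hzx
                · simp [h6]
                · simp [h7]
                · simp
              simpa using card_le_card h5
            omega
          · rw [count_eq_zero_of_notMem hz]; exact Nat.zero_le _
    obtain ⟨L, hL, hneL, rfl⟩ := ih S₂ hcard hc2
    refine ⟨(x, y) ::ₘ L, by simp [hL], ?_, by simpa using cons_swap x y _⟩
    intro q hq
    rcases mem_cons.1 hq with rfl | hq
    · exact hyx.symm
    · exact hneL q hq

end

section

open scoped Pointwise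

/-- The set of all sums obtained by choosing one element from each pair. -/
def pairSums {A : Type*} [AddCommGroup A] [DecidableEq A] : List (A × A) → Finset A
  | [] => {0}
  | q :: l => ({q.1, q.2} : Finset A) + pairSums l

variable {A : Type*} [AddCommGroup A] [DecidableEq A]

theorem pairSums_nonempty (l : List (A × A)) : (pairSums l).Nonempty := by
  induction l with
  | nil => simp [pairSums]
  | cons q l ih => exact Finset.Nonempty.add (by simp) ih

theorem exists_of_mem_pairSums {l : List (A × A)} {y : A} (h : y ∈ pairSums l) :
    ∃ T : Multiset A, T ≤ (l : Multiset (A × A)).map Prod.fst + (l : Multiset (A × A)).map Prod.snd ∧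
      card T = l.length ∧ T.sum = y := by
  induction l generalizing y with
  | nil => exact ⟨0, by simp, by simp, by simpa [pairSums, eq_comm] using h⟩
  | cons q l ih =>
    obtain ⟨a, ha, b, hb, rfl⟩ := Finset.mem_add.1 h
    obtain ⟨T, hT, hc, rfl⟩ := ih hb
    refine ⟨a ::ₘ T, ?_, by simp [hc], by simp⟩
    rw [← Multiset.cons_coe, map_cons, map_cons, Multiset.cons_add, Multiset.add_cons]
    rcases (by simpa using ha : a = q.1 ∨ a = q.2) with rfl | rfl
    · exact cons_le_cons _ (hT.trans (le_cons_self _ _))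
    · rw [cons_swap]
      exact cons_le_cons _ (hT.trans (le_cons_self _ _))

theorem le_card_pair_add {p : ℕ} [Fact p.Prime] (q : ZMod p × ZMod p) (hq : q.1 ≠ q.2)
    (X : Finset (ZMod p)) (hX : X.Nonempty) {k : ℕ} (h : min p k ≤ X.card) :
    min p (k + 1) ≤ (({q.1, q.2} : Finset (ZMod p)) + X).card := by
  have h1 := ZMod.cauchy_davenport (Fact.out : p.Prime) (s := {q.1, q.2}) (t := X) (by simp) hX
  rw [Finset.card_pair hq] at h1
  have := hX.card_pos
  omega

theorem le_card_pairSums {p : ℕ} [Fact p.Prime] (l : List (ZMod p × ZMod p))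
    (hl : ∀ q ∈ l, q.1 ≠ q.2) : min p (l.length + 1) ≤ (pairSums l).card := by
  induction l with
  | nil => simp [pairSums]
  | cons q l ih =>
    exact le_card_pair_add q (hl q (by simp)) _ (pairSums_nonempty l)
      (ih fun q hq => hl q (by simp [hq]))

/-- Differences that are distinct even up to sign give four sums from two pairs, one more than
Cauchy–Davenport guarantees. This surplus lets p - 2 pairs already cover `ZMod p`. -/
theorem le_card_pairSums_of_ne {p : ℕ} [Fact p.Prime] (q₁ q₂ : ZMod p × ZMod p)
    (l : List (ZMod p × ZMod p)) (hl : ∀ q ∈ l, q.1 ≠ q.2) (h₁ : q₁.1 ≠ q₁.2) (h₂ : q₂.1 ≠ q₂.2)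
    (h : q₁.2 - q₁.1 ≠ q₂.2 - q₂.1) (h' : q₁.2 - q₁.1 ≠ q₂.1 - q₂.2) :
    min p (l.length + 4) ≤ (pairSums (q₁ :: q₂ :: l)).card := by
  have h4 : (({q₁.1, q₁.2} : Finset (ZMod p)) + {q₂.1, q₂.2}).card = 4 := by
    have : (({q₁.1, q₁.2} : Finset (ZMod p)) + {q₂.1, q₂.2}) =
        {q₁.1 + q₂.1, q₁.1 + q₂.2, q₁.2 + q₂.1, q₁.2 + q₂.2} := by
      ext z
      simp [Finset.mem_add]
      tauto
    rw [this]
    rw [Finset.card_insert_of_notMem, Finset.card_insert_of_notMem, Finset.card_pair]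
    · simpa using h₂
    · simp only [Finset.mem_insert, Finset.mem_singleton, not_or]
      refine ⟨fun e => h ?_, ?_⟩
      · linear_combination -e
      · simpa using h₁
    · simp only [Finset.mem_insert, Finset.mem_singleton, not_or]
      refine ⟨by simpa using h₂, by simpa using h₁, fun e => h' ?_⟩
      linear_combination -e
  have h1 := ZMod.cauchy_davenport (Fact.out : p.Prime)
    (s := ({q₁.1, q₁.2} : Finset (ZMod p)) + {q₂.1, q₂.2}) (t := pairSums l)
    (Finset.card_pos.1 (by omega)) (pairSums_nonempty l)
  have h2 := le_card_pairSums l hl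
  rw [h4] at h1
  simp only [pairSums, ← add_assoc]
  omega

end

/-! ### Inverse Erdős–Ginzburg–Ziv theorem: prime modulus -/

/-- `InverseEGZ n`: a sequence of length `2 * (n - 1)` over `ZMod n` without zero-sum
subsequence of length `n` consists of two elements, each repeated `n - 1` times. -/
def InverseEGZ (n : ℕ) : Prop :=
  ∀ S : Multiset (ZMod n), card S = 2 * (n - 1) → ZeroSumFreeAt n S →
    ∃ g h, S = replicate (n - 1) g + replicate (n - 1) h

theorem sub_eq_or_of_ne_zmod_three :
    ∀ a b c d : ZMod 3, a ≠ b → c ≠ d → b - a = d - c ∨ b - a = c - d := by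
  decide

/-- If two differences were unrelated, one choice from each of p - 2 pairs would reach every
residue. Cancelling the sum of the one remaining pair, used in full, would give a zero-sum
subsequence of length p. For p = 3 no pair remains, but there all nonzero differences agree up to
sign. -/
theorem pair_differences {p : ℕ} [Fact p.Prime] (L : Multiset (ZMod p × ZMod p))
    (hL : card L = p - 1) (hne : ∀ q ∈ L, q.1 ≠ q.2)
    (hS : ZeroSumFreeAt p (L.map Prod.fst + L.map Prod.snd))
    (q₁ q₂ : ZMod p × ZMod p) (h₁ : q₁ ∈ L) (h₂ : q₂ ∈ L) :
    q₁.2 - q₁.1 = q₂.2 - q₂.1 ∨ q₁.2 - q₁.1 = q₂.1 - q₂.2 := by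
  classical
  by_contra! hcon
  have hq : q₂ ≠ q₁ := by rintro rfl; exact hcon.1 rfl
  obtain ⟨L₁, rfl⟩ := exists_cons_of_mem h₁
  obtain ⟨L₂, rfl⟩ := exists_cons_of_mem ((mem_cons.1 h₂).resolve_left hq)
  have hp2 := (Fact.out : p.Prime).two_le
  rcases L₂.empty_or_exists_mem with rfl | ⟨q₃, h₃⟩
  · have hp : p = 3 := by simp at hL; omega
    subst hp
    have := sub_eq_or_of_ne_zmod_three q₁.1 q₁.2 q₂.1 q₂.2 (hne _ h₁) (hne _ h₂)
    tauto
  · obtain ⟨L₃, rfl⟩ := exists_cons_of_mem h₃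
    obtain ⟨l, rfl⟩ := Quot.exists_rep L₃
    change ZeroSumFreeAt p (map Prod.fst (q₁ ::ₘ q₂ ::ₘ q₃ ::ₘ (l : Multiset (ZMod p × ZMod p))) +
      map Prod.snd (q₁ ::ₘ q₂ ::ₘ q₃ ::ₘ (l : Multiset (ZMod p × ZMod p)))) at hS
    replace hL : l.length + 3 = p - 1 := by simpa using hL
    have hcard := le_card_pairSums_of_ne q₁ q₂ l (fun q hq => hne q (by simp [hq]))
      (hne _ h₁) (hne _ h₂) hcon.1 hcon.2
    rw [min_eq_left (by omega)] at hcard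
    have huniv : pairSums (q₁ :: q₂ :: l) = Finset.univ := by
      apply Finset.eq_univ_of_card
      rw [ZMod.card]
      refine le_antisymm ?_ hcard
      simpa [ZMod.card] using Finset.card_le_univ (pairSums (q₁ :: q₂ :: l))
    obtain ⟨T, hT, hc, hsum⟩ := exists_of_mem_pairSums
      (l := q₁ :: q₂ :: l) (y := -(q₃.1 + q₃.2)) (by rw [huniv]; simp)
    refine hS (q₃.1 ::ₘ q₃.2 ::ₘ T) ?_ (by simp [hc]; omega) (by simp [hsum])
    rw [← Multiset.cons_coe, ← Multiset.cons_coe] at hT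
    have : map Prod.fst (q₁ ::ₘ q₂ ::ₘ q₃ ::ₘ (l : Multiset (ZMod p × ZMod p))) +
        map Prod.snd (q₁ ::ₘ q₂ ::ₘ q₃ ::ₘ (l : Multiset (ZMod p × ZMod p))) =
        q₃.1 ::ₘ q₃.2 ::ₘ (map Prod.fst (q₁ ::ₘ q₂ ::ₘ (l : Multiset (ZMod p × ZMod p))) +
        map Prod.snd (q₁ ::ₘ q₂ ::ₘ (l : Multiset (ZMod p × ZMod p)))) := by
      simp only [map_cons]
      simp only [← singleton_add]
      abel
    rw [this]
    exact cons_le_cons _ (cons_le_cons _ hT)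

theorem count_lt_of_zeroSumFreeAt {G : Type*} [AddCommGroup G] [DecidableEq G] {n : ℕ}
    {S : Multiset G} (hS : ZeroSumFreeAt n S) (x : G) (hx : n • x = 0) : count x S < n := by
  by_contra! h
  exact hS (replicate n x) (le_count_iff_replicate_le.1 h) (by simp) (by simpa using hx)

theorem inverseEGZ_prime {p : ℕ} (hp : p.Prime) : InverseEGZ p := by
  classical
  have : Fact p.Prime := ⟨hp⟩
  intro S hcard hS
  have hp2 := hp.two_le
  obtain ⟨L, hL, hne, rfl⟩ := exists_pairs_ne (p - 1) S hcard (fun x => by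
    have := count_lt_of_zeroSumFreeAt hS x (by simp)
    omega)
  have hd := pair_differences L hL hne hS
  obtain ⟨q₀, hq₀⟩ : ∃ q, q ∈ L := by
    apply exists_mem_of_ne_zero
    rintro rfl
    simp at hL
    omega
  set d := q₀.2 - q₀.1 with hd_def
  have hd0 : d ≠ 0 := sub_ne_zero.2 (hne _ hq₀).symm
  -- orient every pair as `(a, a + d)`
  obtain ⟨A, hA, hAS⟩ : ∃ A : Multiset (ZMod p), card A = p - 1 ∧
      L.map Prod.fst + L.map Prod.snd = A + A.map (· + d) := by
    have hall : ∀ q ∈ L, q.2 = q.1 + d ∨ q.1 = q.2 + d := by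
      intro q hq
      rcases hd q₀ q hq₀ hq with h | h
      · left; rw [hd_def, h]; ring
      · right; rw [hd_def, h]; ring
    rw [← hL]
    clear hd hq₀ hne hS hcard hL
    clear_value d
    induction L using Multiset.induction_on with
    | empty => exact ⟨0, by simp, by simp⟩
    | cons q L ih =>
      obtain ⟨A, h1, h2⟩ := ih fun q hq => hall q (by simp [hq])
      rcases hall q (by simp) with h | h
      · refine ⟨q.1 ::ₘ A, by simp [h1], ?_⟩
        simp only [map_cons, ← h]
        rw [cons_add, add_cons, h2, cons_add, add_cons]
      · refine ⟨q.2 ::ₘ A, by simp [h1], ?_⟩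
        simp only [map_cons, ← h]
        rw [cons_add, add_cons, h2, cons_add, add_cons, cons_swap]
  rw [hAS] at hS ⊢
  -- Use both a and a + d, and one member of each other pair. Shifting j of these by d gives the sum
  -- a + σ(A) + (j + 1)d with 0 ≤ j ≤ p - 2, so j + 1 reaches every nonzero residue; only a = -σ(A)
  -- escapes.
  have hall : ∀ a ∈ A, a = -A.sum := by
    intro a ha
    by_contra hcon
    obtain ⟨A', rfl⟩ := exists_cons_of_mem ha
    have hA' : card A' = p - 2 := by simp at hA; omega
    set y := -(a + (a ::ₘ A').sum) / d with hy
    have hy0 : y ≠ 0 := by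
      refine div_ne_zero (fun h => hcon ?_) hd0
      linear_combination -h
    have hyd : y * d = -(a + (a ::ₘ A').sum) := by rw [hy]; field_simp
    have hyv : 1 ≤ y.val := Nat.one_le_iff_ne_zero.2 (by rwa [Ne, ZMod.val_eq_zero])
    have hylt := ZMod.val_lt y
    obtain ⟨A₁, hA₁, hc₁⟩ := exists_le_card A' (k := y.val - 1) (by omega)
    obtain ⟨A₂, rfl⟩ := Multiset.le_iff_exists_add.1 hA₁
    refine hS (a ::ₘ (a + d) ::ₘ (A₂ + A₁.map (· + d))) ?_ ?_ ?_
    · refine Multiset.le_iff_exists_add.2 ⟨A₁ + A₂.map (· + d), ?_⟩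
      simp only [map_cons, Multiset.map_add]
      simp only [← singleton_add]
      abel
    · simp at hA' ⊢
      omega
    · have hcast : ((y.val - 1 : ℕ) : ZMod p) = y - 1 := by
        rw [Nat.cast_sub hyv, ZMod.natCast_zmod_val, Nat.cast_one]
      simp only [sum_cons, sum_add, sum_map_add, map_id', map_const', sum_replicate, hc₁,
        nsmul_eq_mul, hcast] at hyd ⊢
      linear_combination hyd
  have hrep := eq_replicate.2 ⟨hA, hall⟩
  refine ⟨-A.sum, -A.sum + d, ?_⟩
  conv_lhs => rw [hrep]
  simp

/-! ### Extremal sequences in a cyclic subgroup -/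

section

variable {A : Type*} [AddCommGroup A]

theorem exists_zmod_hom {e : A} {n : ℕ} (he : addOrderOf e = n) :
    ∃ φ : ZMod n →+ A, Function.Injective φ ∧ ∀ x ∈ AddSubgroup.zmultiples e, ∃ k, φ k = x := by
  subst he
  refine ⟨ZMod.lift _ ⟨zmultiplesHom A e, by simp [addOrderOf_nsmul_eq_zero]⟩, ?_, ?_⟩
  · rw [ZMod.lift_injective]
    intro k hk
    rw [ZMod.intCast_zmod_eq_zero_iff_dvd]
    exact addOrderOf_dvd_iff_zsmul_eq_zero.2 (by simpa using hk)
  · rintro _ ⟨k, rfl⟩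
    exact ⟨k, by simp⟩

theorem exists_map_eq_of_forall {α β : Type*} {f : α → β} {P : Multiset β}
    (h : ∀ x ∈ P, ∃ k, f k = x) : ∃ Q : Multiset α, Q.map f = P := by
  induction P using Multiset.induction_on with
  | empty => exact ⟨0, rfl⟩
  | cons x P ih =>
    obtain ⟨k, rfl⟩ := h x (by simp)
    obtain ⟨Q, rfl⟩ := ih fun y hy => h y (by simp [hy])
    exact ⟨k ::ₘ Q, by simp⟩

theorem ZeroSumFreeAt.of_map {B : Type*} [AddCommGroup B] {φ : A →+ B} {n : ℕ} {Q : Multiset A}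
    (h : ZeroSumFreeAt n (Q.map φ)) : ZeroSumFreeAt n Q := by
  intro T hT hc hs
  refine h (T.map φ) (map_le_map hT) (by simpa using hc) ?_
  rw [← map_multiset_sum, hs, _root_.map_zero]

theorem ZeroSumFreeAt.card_lt_zmod {n : ℕ} {Q : Multiset (ZMod n)} (h : ZeroSumFreeAt n Q) :
    card Q < 2 * n - 1 := by
  by_contra! hc
  obtain ⟨T, hT, h1, h2⟩ := ZMod.erdos_ginzburg_ziv_multiset Q hc
  exact h T hT h1 h2

theorem ZeroSumFreeAt.card_lt {e : A} {n : ℕ} (he : addOrderOf e = n) {P : Multiset A}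
    (hP : ∀ x ∈ P, x ∈ AddSubgroup.zmultiples e) (h : ZeroSumFreeAt n P) :
    card P < 2 * n - 1 := by
  obtain ⟨φ, hφ, hsurj⟩ := exists_zmod_hom he
  obtain ⟨Q, rfl⟩ := exists_map_eq_of_forall fun x hx => hsurj x (hP x hx)
  simpa using h.of_map.card_lt_zmod

theorem ZeroSumFreeAt.eq_replicate_add {e : A} {n : ℕ} (he : addOrderOf e = n)
    (hn : InverseEGZ n) {P : Multiset A} (hP : ∀ x ∈ P, x ∈ AddSubgroup.zmultiples e)
    (hc : card P = 2 * (n - 1)) (h : ZeroSumFreeAt n P) :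
    ∃ g h, P = replicate (n - 1) g + replicate (n - 1) h := by
  obtain ⟨φ, hφ, hsurj⟩ := exists_zmod_hom he
  obtain ⟨Q, rfl⟩ := exists_map_eq_of_forall fun x hx => hsurj x (hP x hx)
  obtain ⟨g, g', rfl⟩ := hn Q (by simpa using hc) h.of_map
  exact ⟨φ g, φ g', by simp⟩

theorem count_eq_of_eq_replicate_add [DecidableEq A] {n : ℕ} {P : Multiset A} {g h : A}
    (hP : P = replicate (n - 1) g + replicate (n - 1) h) (hfree : ZeroSumFreeAt n P)
    (hg : n • g = 0) (hn : 2 ≤ n) {z : A} (hz : z ∈ P) : count z P = n - 1 := by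
  have hne : g ≠ h := by
    rintro rfl
    have := count_lt_of_zeroSumFreeAt hfree g hg
    rw [hP] at this
    simp at this
    omega
  have hz' : z = g ∨ z = h := by
    rw [hP, mem_add] at hz
    exact hz.imp eq_of_mem_replicate eq_of_mem_replicate
  rw [hP, count_add, count_replicate, count_replicate]
  rcases hz' with rfl | rfl
  · simp [hne.symm]
  · simp [hne]

/-- For n ≥ 3, every term of an extremal sequence has multiplicity n - 1, so y occurs n - 2 > 0
times in `P`. If x ≠ y, it would then occur with the wrong multiplicity in `x ::ₘ P`. The case n = 2
is finite. -/
theorem eq_of_zeroSumFreeAt_cons_zmod {n : ℕ} (hn : 2 ≤ n) (hI : InverseEGZ n)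
    {P : Multiset (ZMod n)} (hc : card P + 1 = 2 * (n - 1)) {x y : ZMod n}
    (hx : ZeroSumFreeAt n (x ::ₘ P)) (hy : ZeroSumFreeAt n (y ::ₘ P)) : x = y := by
  classical
  rcases hn.eq_or_lt with rfl | hn3
  · obtain ⟨p, rfl⟩ := card_eq_one.1 (by omega : card P = 1)
    have h1 : x + p ≠ 0 := by simpa using hx _ le_rfl (by simp)
    have h2 : y + p ≠ 0 := by simpa using hy _ le_rfl (by simp)
    revert h1 h2
    clear hx hy hc hI
    revert x y p
    decide
  · by_contra hne
    obtain ⟨g, h, h1⟩ := hI _ (by simpa using hc) hx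
    obtain ⟨g', h', h2⟩ := hI _ (by simpa using hc) hy
    have h3 := count_eq_of_eq_replicate_add h2 hy (by simp) hn (mem_cons_self y P)
    rw [count_cons_self] at h3
    have h4 : y ∈ x ::ₘ P := mem_cons_of_mem (count_pos.1 (by omega))
    have h5 := count_eq_of_eq_replicate_add h1 hx (by simp) hn h4
    rw [count_cons_of_ne (Ne.symm hne)] at h5
    omega

theorem eq_of_zeroSumFreeAt_cons {e : A} {n : ℕ} (he : addOrderOf e = n) (hn : 2 ≤ n)
    (hI : InverseEGZ n) {P : Multiset A} (hP : ∀ x ∈ P, x ∈ AddSubgroup.zmultiples e)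
    (hc : card P + 1 = 2 * (n - 1)) {x y : A} (hx' : x ∈ AddSubgroup.zmultiples e)
    (hy' : y ∈ AddSubgroup.zmultiples e)
    (hx : ZeroSumFreeAt n (x ::ₘ P)) (hy : ZeroSumFreeAt n (y ::ₘ P)) : x = y := by
  obtain ⟨φ, hφ, hsurj⟩ := exists_zmod_hom he
  obtain ⟨Q, rfl⟩ := exists_map_eq_of_forall fun x hx => hsurj x (hP x hx)
  obtain ⟨x, rfl⟩ := hsurj x hx'
  obtain ⟨y, rfl⟩ := hsurj y hy'
  rw [← map_cons] at hx hy
  rw [eq_of_zeroSumFreeAt_cons_zmod hn hI (by simpa using hc) hx.of_map hy.of_map]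

end

theorem card_join_of_forall {G : Type*} {t : ℕ} {B : Multiset (Multiset G)} (hB : ∀ X ∈ B, card X = t) :
    card B.join = t * card B := by
  rw [card_join, map_congr rfl hB, map_const', sum_replicate, smul_eq_mul, mul_comm]

/-! ### Blocks with sum in the kernel -/

section Blocks

variable {G V : Type*} [AddCommGroup G] [AddCommGroup V]

/-- A block of length `t`: a sequence of length `t` whose sum is killed by `c`. -/
def IsBlock (c : G →+ V) (t : ℕ) (X : Multiset G) : Prop :=
  card X = t ∧ c X.sum = 0

theorem ZeroSumFreeAt.map_sum {t m : ℕ} {B : Multiset (Multiset G)} {S : Multiset G}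
    (hS : ZeroSumFreeAt (t * m) S) (hB : ∀ X ∈ B, card X = t) (hle : B.join ≤ S) :
    ZeroSumFreeAt m (B.map sum) := by
  intro Q hQ hc hs
  obtain ⟨B', hB', rfl⟩ := exists_le_map_eq sum B hQ
  refine hS B'.join ((join_le_join hB').trans hle) ?_ (by rw [sum_join, hs])
  rw [card_join_of_forall fun X hX => hB X (mem_of_le hB' hX)]
  simpa using Or.inl hc

variable {c : G →+ V} {e : G} {m t : ℕ} {S : Multiset G}

theorem mem_zmultiples_of_mem_map_sum (hker : ∀ x, c x = 0 → x ∈ AddSubgroup.zmultiples e)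
    {B : Multiset (Multiset G)} (hB : ∀ X ∈ B, IsBlock c t X) :
    ∀ x ∈ B.map sum, x ∈ AddSubgroup.zmultiples e := by
  intro x hx
  obtain ⟨X, hX, rfl⟩ := mem_map.1 hx
  exact hker _ (hB X hX).2

theorem card_blocks_lt (he : addOrderOf e = m)
    (hker : ∀ x, c x = 0 → x ∈ AddSubgroup.zmultiples e) (hS : ZeroSumFreeAt (t * m) S)
    {B : Multiset (Multiset G)} (hB : ∀ X ∈ B, IsBlock c t X) (hle : B.join ≤ S) :
    card B < 2 * m - 1 := by
  simpa using (hS.map_sum (fun X hX => (hB X hX).1) hle).card_lt he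
    (mem_zmultiples_of_mem_map_sum hker hB)

/-- Two blocks that complete the same `2 * m - 3` blocks have the same sum. -/
theorem sum_eq_of_blocks (he : addOrderOf e = m) (hm : 2 ≤ m) (hI : InverseEGZ m)
    (hker : ∀ x, c x = 0 → x ∈ AddSubgroup.zmultiples e) (hS : ZeroSumFreeAt (t * m) S)
    {B : Multiset (Multiset G)} (hB : ∀ X ∈ B, IsBlock c t X) (hcard : card B + 1 = 2 * (m - 1))
    {X Y : Multiset G} (hX : IsBlock c t X) (hY : IsBlock c t Y) (hXle : X + B.join ≤ S)
    (hYle : Y + B.join ≤ S) : X.sum = Y.sum := by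
  refine eq_of_zeroSumFreeAt_cons he hm hI (mem_zmultiples_of_mem_map_sum hker hB)
    (by simpa using hcard) (hker _ hX.2) (hker _ hY.2) ?_ ?_
  · rw [← map_cons]
    refine hS.map_sum ?_ (by rwa [join_cons])
    intro Z hZ
    rcases mem_cons.1 hZ with rfl | hZ
    exacts [hX.1, (hB Z hZ).1]
  · rw [← map_cons]
    refine hS.map_sum ?_ (by rwa [join_cons])
    intro Z hZ
    rcases mem_cons.1 hZ with rfl | hZ
    exacts [hY.1, (hB Z hZ).1]

end Blocks

/-! ### Inverse Erdős–Ginzburg–Ziv theorem: composite modulus -/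

section Composite

variable {G : Type*} [AddCommGroup G] {a b : ℕ}

theorem exists_block (c : G →+ ZMod a) {U : Multiset G} (hU : 2 * a - 1 ≤ card U) :
    ∃ X ≤ U, IsBlock c a X := by
  obtain ⟨T, hT, h1, h2⟩ := ZMod.erdos_ginzburg_ziv_multiset (U.map c) (by simpa using hU)
  obtain ⟨X, hX, rfl⟩ := exists_le_map_eq c U hT
  exact ⟨X, hX, by simpa using h1, by rw [map_multiset_sum, h2]⟩

theorem exists_blocks (c : G →+ ZMod a) (ha : 0 < a) {S : Multiset G} (k : ℕ)
    (hS : a * k + a - 1 ≤ card S) :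
    ∃ B : Multiset (Multiset G), card B = k ∧ (∀ X ∈ B, IsBlock c a X) ∧ B.join ≤ S := by
  induction k with
  | zero => exact ⟨0, by simp, by simp, by simp⟩
  | succ k ih =>
    rw [mul_add, mul_one] at hS
    obtain ⟨B, h1, h2, h3⟩ := ih (by omega)
    obtain ⟨U, rfl⟩ := Multiset.le_iff_exists_add.1 h3
    rw [card_add, card_join_of_forall fun X hX => (h2 X hX).1, h1] at hS
    obtain ⟨X, hX, hb⟩ := exists_block c (U := U) (by omega)
    refine ⟨X ::ₘ B, by simp [h1], ?_, ?_⟩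
    · intro Z hZ
      rcases mem_cons.1 hZ with rfl | hZ
      exacts [hb, h2 Z hZ]
    · rw [join_cons, add_comm]
      exact add_le_add_right hX _

theorem eq_of_sum_cons_replicate {k : ℕ} {α γ : ZMod (k + 1)}
    (h : (α ::ₘ replicate k γ).sum = 0) : α = γ := by
  have h0 : (k : ZMod (k + 1)) + 1 = 0 := by exact_mod_cast ZMod.natCast_self (k + 1)
  simp only [sum_cons, sum_replicate, nsmul_eq_mul] at h
  linear_combination h - γ * h0

/-- The hypothesis `hex` says that replacing the block X by any other zero-sum block Y inside X and
the remainder leaves an extremal remainder. If X contains α, taking Y = α^a forces the rest of X to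
be constant. The case where X avoids both values is excluded by a block through some b in X. -/
theorem eq_replicate_of_exchange (ha : 2 ≤ a) {X : Multiset (ZMod a)} (hX : card X = a)
    (hsum : X.sum = 0) {α β : ZMod a}
    (hR : ZeroSumFreeAt a (replicate (a - 1) α + replicate (a - 1) β))
    (hex : ∀ Y Z, Y + Z = X + (replicate (a - 1) α + replicate (a - 1) β) → card Y = a →
      Y.sum = 0 → ∃ α' β', Z = replicate (a - 1) α' + replicate (a - 1) β') :
    X = replicate a α ∨ X = replicate a β := by
  classical
  obtain ⟨k, rfl⟩ : ∃ k, a = k + 1 := ⟨a - 1, by omega⟩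
  simp only [Nat.add_sub_cancel] at *
  have pure : ∀ α β : ZMod (k + 1), (∀ Y Z, Y + Z = X + (replicate k α + replicate k β) →
      card Y = k + 1 → Y.sum = 0 → ∃ α' β', Z = replicate k α' + replicate k β') →
      α ∈ X → X = replicate (k + 1) α := by
    intro α β hex hα
    obtain ⟨X', rfl⟩ := exists_cons_of_mem hα
    obtain ⟨α', β', h⟩ := hex (replicate (k + 1) α) (X' + replicate k β)
      (by simp only [replicate_succ, ← singleton_add]; abel) (by simp)
      (by
        have h0 : (k : ZMod (k + 1)) + 1 = 0 := by exact_mod_cast ZMod.natCast_self (k + 1)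
        simp only [sum_replicate, nsmul_eq_mul, Nat.cast_add, Nat.cast_one, h0, zero_mul])
    have hβ : β ∈ replicate k α' + replicate k β' := by
      rw [← h, mem_add]
      exact Or.inr (mem_replicate.2 ⟨by omega, rfl⟩)
    obtain ⟨γ, rfl⟩ : ∃ γ, X' = replicate k γ := by
      rcases mem_add.1 hβ with hβ | hβ
      · obtain rfl := eq_of_mem_replicate hβ
        exact ⟨β', add_right_cancel (h.trans (add_comm _ _))⟩
      · obtain rfl := eq_of_mem_replicate hβ
        exact ⟨α', add_right_cancel h⟩
    have : α = γ := eq_of_sum_cons_replicate hsum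
    rw [this, replicate_succ]
  by_cases h1 : α ∈ X
  · exact Or.inl (pure α β hex h1)
  by_cases h2 : β ∈ X
  · exact Or.inr (pure β α (fun Y Z h => hex Y Z (by rw [h]; abel)) h2)
  exfalso
  obtain ⟨b, hb⟩ := card_pos_iff_exists_mem.1 (by omega : 0 < card X)
  obtain ⟨X', rfl⟩ := exists_cons_of_mem hb
  obtain ⟨Y, hY, hYc, hYs⟩ := ZMod.erdos_ginzburg_ziv_multiset
    (b ::ₘ (replicate k α + replicate k β)) (by simp; omega)
  obtain ⟨W, hW⟩ := Multiset.le_iff_exists_add.1 hY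
  have hWc : card W = k := by
    have := congrArg card hW
    simp at this
    omega
  obtain ⟨α', β', h⟩ := hex Y (X' + W)
    (by rw [add_left_comm, ← hW, add_cons, cons_add]) hYc hYs
  have hbW : b ∉ W := by
    intro hbW
    obtain ⟨W', rfl⟩ := exists_cons_of_mem hbW
    rw [add_cons, cons_inj_right] at hW
    exact hR Y (hW ▸ le_add_right _ _) hYc hYs
  have hWv : ∀ w ∈ W, w = α ∨ w = β := by
    intro w hw
    have : w ∈ b ::ₘ (replicate k α + replicate k β) := by
      rw [hW]; exact mem_add.2 (Or.inr hw)
    rcases mem_cons.1 this with rfl | this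
    · exact absurd hw hbW
    · exact (mem_add.1 this).imp eq_of_mem_replicate eq_of_mem_replicate
  have hXW : ∀ x ∈ X', ∀ w ∈ W, x ≠ w := by
    rintro x hx w hw rfl
    rcases hWv x hw with rfl | rfl
    · exact h1 (mem_cons_of_mem hx)
    · exact h2 (mem_cons_of_mem hx)
  have hX'c : card X' = k := by simpa using hX
  obtain ⟨x, hx⟩ := card_pos_iff_exists_mem.1 (by omega : 0 < card X')
  obtain ⟨w, hw⟩ := card_pos_iff_exists_mem.1 (by omega : 0 < card W)
  have hmem : ∀ z ∈ X' + W, z = α' ∨ z = β' := by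
    intro z hz
    rw [h] at hz
    exact (mem_add.1 hz).imp eq_of_mem_replicate eq_of_mem_replicate
  -- `X'` and `W` share no value while together they take only two, so each is constant.
  have hWrep : W = replicate k w := by
    refine eq_replicate.2 ⟨hWc, fun w' hw' => ?_⟩
    have e1 := hmem x (mem_add.2 (Or.inl hx))
    have e2 := hmem w (mem_add.2 (Or.inr hw))
    have e3 := hmem w' (mem_add.2 (Or.inr hw'))
    have n1 := hXW x hx w hw
    have n2 := hXW x hx w' hw'
    clear * - e1 e2 e3 n1 n2
    grind
  have hYw : ∀ w', replicate k α + replicate k β = replicate k w' + W →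
      w' ∈ replicate k α + replicate k β → False := by
    intro w' hw' hmem'
    have hYeq : Y = b ::ₘ replicate k w' := by
      rw [hw', ← cons_add] at hW
      exact (add_right_cancel hW).symm
    rw [hYeq] at hYs
    obtain rfl := eq_of_sum_cons_replicate hYs
    rcases mem_add.1 hmem' with h | h
    · exact h1 (eq_of_mem_replicate h ▸ hb)
    · exact h2 (eq_of_mem_replicate h ▸ hb)
  have hk : k ≠ 0 := by omega
  rcases hWv w hw with rfl | rfl
  · exact hYw β (by rw [hWrep]; exact add_comm _ _) (by simp [mem_replicate, hk])
  · exact hYw α (by rw [hWrep]) (by simp [mem_replicate, hk])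

theorem eq_replicate_add_of_forall {n : ℕ} (hn : 2 ≤ n) (hG : ∀ x : G, n • x = 0) {S : Multiset G}
    (hc : card S = 2 * (n - 1)) (hS : ZeroSumFreeAt n S) {x y : G} (h : ∀ s ∈ S, s = x ∨ s = y) :
    S = replicate (n - 1) x + replicate (n - 1) y := by
  classical
  have hx := count_lt_of_zeroSumFreeAt hS x (hG x)
  have hy := count_lt_of_zeroSumFreeAt hS y (hG y)
  have hne : x ≠ y := by
    rintro rfl
    have h1 : S = replicate (card S) x := eq_replicate_card.2 fun s hs => (h s hs).elim id id
    have h2 : count x S = card S := by rw [h1]; simp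
    omega
  have hS' : S = replicate (count x S) x + replicate (count y S) y := by
    ext z
    rw [count_add, count_replicate, count_replicate]
    split_ifs with h1 h2 h2
    · exact absurd (h1.trans h2.symm) hne
    · simp [h1]
    · simp [h2]
    · rw [count_eq_zero_of_notMem]
      intro hz
      exact (h z hz).elim (fun h => h1 h.symm) fun h => h2 h.symm
  have hcard := congrArg card hS'
  rw [card_add, card_replicate, card_replicate] at hcard
  rw [hS', show count x S = n - 1 by omega, show count y S = n - 1 by omega]

theorem exists_replicate_add_of_mul (ha2 : 2 ≤ a) (hb2 : 2 ≤ b) (ha : InverseEGZ a)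
    (hb : InverseEGZ b) (c : G →+ ZMod a) {e : G} (he : addOrderOf e = b)
    (hker : ∀ x, c x = 0 → x ∈ AddSubgroup.zmultiples e) (hG : ∀ x : G, (a * b) • x = 0)
    {S : Multiset G} (hc : card S = 2 * (a * b - 1)) (hS : ZeroSumFreeAt (a * b) S) :
    ∃ g h, S = replicate (a * b - 1) g + replicate (a * b - 1) h := by
  classical
  have hab : 2 * a ≤ a * b := by rw [mul_comm a b]; exact Nat.mul_le_mul_right a hb2
  have hmul : a * (2 * (b - 1)) = 2 * (a * b) - 2 * a := by
    rw [Nat.mul_left_comm, Nat.mul_sub, mul_one, Nat.mul_sub]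
  have hrem : ∀ (B : Multiset (Multiset G)) (R : Multiset G), (∀ X ∈ B, IsBlock c a X) →
      card B = 2 * (b - 1) → S = B.join + R → ZeroSumFreeAt a (R.map c) ∧
      ∃ α β, R.map c = replicate (a - 1) α + replicate (a - 1) β := by
    intro B R hB hBc hSB
    have hfree : ZeroSumFreeAt a (R.map c) := by
      intro T hT hTc hTs
      obtain ⟨X, hX, rfl⟩ := exists_le_map_eq c R hT
      have := card_blocks_lt (B := X ::ₘ B) he hker hS (t := a) (by
        intro Z hZ
        rcases mem_cons.1 hZ with rfl | hZ
        · exact ⟨by simpa using hTc, by rw [map_multiset_sum, hTs]⟩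
        · exact hB Z hZ) (by rw [hSB, join_cons, add_comm]; exact add_le_add_right hX _)
      rw [card_cons] at this
      omega
    refine ⟨hfree, ha _ ?_ hfree⟩
    have := congrArg card hSB
    rw [card_add, card_join_of_forall fun X hX => (hB X hX).1, hBc, hmul] at this
    rw [card_map]
    omega
  obtain ⟨B, hBc, hB, hle⟩ := exists_blocks c (by omega) (S := S) (2 * (b - 1)) (by omega)
  obtain ⟨R, hSB⟩ := Multiset.le_iff_exists_add.1 hle
  obtain ⟨hfree, α, β, hR⟩ := hrem B R hB hBc hSB
  have hBX : ∀ X ∈ B, X.map c = replicate a α ∨ X.map c = replicate a β := by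
    intro X hX
    obtain ⟨B', rfl⟩ := exists_cons_of_mem hX
    refine eq_replicate_of_exchange ha2 (by simpa using (hB X hX).1)
      (by rw [← map_multiset_sum]; exact (hB X hX).2) (hR ▸ hfree) ?_
    intro Y Z hYZ hYc hYs
    rw [← hR, ← Multiset.map_add] at hYZ
    obtain ⟨Y', hY', rfl⟩ := exists_le_map_eq c (X + R) (hYZ ▸ le_add_right Y Z)
    obtain ⟨Z', hZ'⟩ := Multiset.le_iff_exists_add.1 hY'
    rw [hZ', Multiset.map_add] at hYZ
    rw [add_left_cancel hYZ]
    refine (hrem (Y' ::ₘ B') Z' ?_ (by simpa using hBc) ?_).2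
    · intro W hW
      rcases mem_cons.1 hW with rfl | hW
      · exact ⟨by simpa using hYc, by rw [map_multiset_sum, hYs]⟩
      · exact hB W (mem_cons_of_mem hW)
    · rw [hSB, join_cons, join_cons, add_right_comm, hZ', add_right_comm]
  -- Exchanging x for r keeps a block and leaves the other blocks untouched, so uniqueness of the
  -- completion makes both block sums equal.
  have hswap : ∀ X ∈ B, ∀ x ∈ X, ∀ r ∈ R, c x = c r → x = r := by
    intro X hX x hx r hr hxr
    obtain ⟨B', rfl⟩ := exists_cons_of_mem hX
    have hbX := hB X hX
    obtain ⟨X', rfl⟩ := exists_cons_of_mem hx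
    obtain ⟨R', rfl⟩ := exists_cons_of_mem hr
    have := sum_eq_of_blocks he hb2 hb hker hS (fun W hW => hB W (mem_cons_of_mem hW))
      (by simpa using hBc) hbX (Y := r ::ₘ X')
      ⟨by simpa using hbX.1, by simpa [hxr] using hbX.2⟩
      (by rw [hSB, join_cons]; exact le_add_right _ _)
      (by
        rw [hSB, join_cons]
        refine Multiset.le_iff_exists_add.2 ⟨x ::ₘ R', ?_⟩
        simp only [← singleton_add]
        abel)
    simpa using this
  -- Otherwise all 2a(b - 1) ≥ ab block terms would equal r. Hence both classes occur in blocks, and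
  -- two remainder terms of one class can be compared through a block term.
  have hex : ∀ r ∈ R, ∃ X ∈ B, ∃ x ∈ X, c x ≠ c r := by
    intro r hr
    by_contra! hall
    have hrep : B.join = replicate (card B.join) r := by
      refine eq_replicate_card.2 fun x hx => ?_
      obtain ⟨X, hX, hx⟩ := mem_join.1 hx
      exact hswap X hX x hx r hr (hall X hX x hx)
    have h1 := count_lt_of_zeroSumFreeAt hS r (hG r)
    have h2 : count r B.join = card B.join := by rw [hrep]; simp
    have h3 := count_le_of_le r hle
    rw [h2, card_join_of_forall fun X hX => (hB X hX).1, hBc, hmul] at h3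
    omega
  have hmemR : ∀ γ, γ = α ∨ γ = β → ∃ r ∈ R, c r = γ := by
    intro γ hγ
    have : γ ∈ R.map c := by
      rw [hR, mem_add, mem_replicate, mem_replicate]
      exact hγ.imp (fun h => ⟨by omega, h⟩) fun h => ⟨by omega, h⟩
    simpa using this
  obtain ⟨r₁, hr₁, hc₁⟩ := hmemR α (Or.inl rfl)
  obtain ⟨r₂, hr₂, hc₂⟩ := hmemR β (Or.inr rfl)
  have hclass : ∀ X ∈ B, ∀ x ∈ X, c x = α ∨ c x = β := by
    intro X hX x hx
    have hx' := mem_map_of_mem c hx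
    rcases hBX X hX with h | h <;> rw [h] at hx'
    exacts [Or.inl (eq_of_mem_replicate hx'), Or.inr (eq_of_mem_replicate hx')]
  refine ⟨r₁, r₂, eq_replicate_add_of_forall (by omega) hG hc hS fun s hs => ?_⟩
  rw [hSB, mem_add] at hs
  rcases hs with hs | hs
  · obtain ⟨X, hX, hs⟩ := mem_join.1 hs
    exact (hclass X hX s hs).imp (fun h => hswap X hX s hs r₁ hr₁ (h.trans hc₁.symm))
      fun h => hswap X hX s hs r₂ hr₂ (h.trans hc₂.symm)
  · have hs' := mem_map_of_mem c hs
    rw [hR, mem_add] at hs'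
    rcases hs' with h | h
    · left
      obtain ⟨X, hX, x, hx, hne⟩ := hex r₂ hr₂
      have hxα := (hclass X hX x hx).resolve_right fun h => hne (h.trans hc₂.symm)
      rw [← hswap X hX x hx s hs (hxα.trans (eq_of_mem_replicate h).symm)]
      exact hswap X hX x hx r₁ hr₁ (hxα.trans hc₁.symm)
    · right
      obtain ⟨X, hX, x, hx, hne⟩ := hex r₁ hr₁
      have hxβ := (hclass X hX x hx).resolve_left fun h => hne (h.trans hc₁.symm)
      rw [← hswap X hX x hx s hs (hxβ.trans (eq_of_mem_replicate h).symm)]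
      exact hswap X hX x hx r₂ hr₂ (hxβ.trans hc₂.symm)

theorem inverseEGZ_mul (ha : InverseEGZ a) (hb : InverseEGZ b) : InverseEGZ (a * b) := by
  intro S hc hS
  rcases lt_or_ge a 2 with ha2 | ha2
  · interval_cases a
    · exact ⟨0, 0, by simpa using hc⟩
    · have h : InverseEGZ (1 * b) := by rwa [one_mul]
      exact h S hc hS
  rcases lt_or_ge b 2 with hb2 | hb2
  · interval_cases b
    · exact ⟨0, 0, by simpa using hc⟩
    · have h : InverseEGZ (a * 1) := by rwa [mul_one]
      exact h S hc hS
  have : NeZero (a * b) := ⟨by positivity⟩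
  refine exists_replicate_add_of_mul ha2 hb2 ha hb
    (ZMod.castHom (dvd_mul_right a b) (ZMod a)).toAddMonoidHom (e := (a : ZMod (a * b))) ?_ ?_ ?_
    hc hS
  · rw [ZMod.addOrderOf_coe a (NeZero.ne (a * b)), Nat.gcd_mul_right_left,
      Nat.mul_div_cancel_left b (by omega)]
  · intro x hx
    rw [← ZMod.natCast_zmod_val x] at hx ⊢
    have hx' : ((x.val : ℕ) : ZMod a) = 0 := by simpa using hx
    rw [ZMod.natCast_eq_zero_iff] at hx'
    obtain ⟨k, hk⟩ := hx'
    exact ⟨k, by simp [hk, mul_comm]⟩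
  · intro x
    rw [nsmul_eq_mul, ZMod.natCast_self, zero_mul]

theorem inverseEGZ (n : ℕ) : InverseEGZ n := by
  induction n using Nat.recOnMul with
  | zero => exact fun S hS _ => ⟨0, 0, by simpa using hS⟩
  | one => exact fun S hS _ => ⟨0, 0, by simpa using hS⟩
  | prime p hp => exact inverseEGZ_prime hp
  | mul a b ha hb => exact inverseEGZ_mul ha hb

end Composite

/-! ### Pairs and quadruples for classes in C_2^3 -/

/-- The list consists of the four parallel lines with direction α + β in the affine space over F_2.
Quadruples of distinct classes with sum zero are its affine planes. -/
theorem exists_frame (α β : ZMod 2 × ZMod 2 × ZMod 2) (h : α ≠ β) :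
    ∃ u v, [α, β, α + u, β + u, α + v, β + v, α + (u + v), β + (u + v)].Nodup := by
  revert α β
  decide

theorem mem_frame (α β u v w : ZMod 2 × ZMod 2 × ZMod 2)
    (h : [α, β, α + u, β + u, α + v, β + v, α + (u + v), β + (u + v)].Nodup) :
    w ∈ [α, β, α + u, β + u, α + v, β + v, α + (u + v), β + (u + v)] := by
  have h1 := List.toFinset_card_of_nodup h
  have h2 : [α, β, α + u, β + u, α + v, β + v, α + (u + v), β + (u + v)].toFinset = Finset.univ :=
    Finset.eq_univ_of_card _ h1
  rw [← List.mem_toFinset, h2]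
  exact Finset.mem_univ w

theorem two_nsmul_class (α : ZMod 2 × ZMod 2 × ZMod 2) : α + α = 0 := by
  revert α
  decide

theorem class_eq_of_add_eq_zero {α β : ZMod 2 × ZMod 2 × ZMod 2} (h : α + β = 0) : α = β := by
  rw [← two_nsmul_class β] at h
  exact add_right_cancel h

section

variable {G : Type*} [AddCommGroup G] {c : G →+ ZMod 2 × ZMod 2 × ZMod 2} {e : G} {n : ℕ}
  {S : Multiset G}

theorem exists_pairs_add (c : G →+ ZMod 2 × ZMod 2 × ZMod 2) (S : Multiset G) :
    ∃ (B : Multiset (Multiset G)) (R : Multiset G), S = B.join + R ∧ (∀ X ∈ B, IsBlock c 2 X) ∧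
      (R.map c).Nodup := by
  induction h : card S using Nat.strong_induction_on generalizing S with
  | _ k ih =>
    by_cases hn : (S.map c).Nodup
    · exact ⟨0, S, by simp, by simp, hn⟩
    · rw [nodup_iff_le] at hn
      push Not at hn
      obtain ⟨v, hv⟩ := hn
      obtain ⟨X, hX, hXc⟩ := exists_le_map_eq c S hv
      obtain ⟨S', rfl⟩ := Multiset.le_iff_exists_add.1 hX
      have hcard : card X = 2 := by simpa using congrArg card hXc
      obtain ⟨B, R, rfl, hB, hR⟩ := ih (card S') (by rw [← h, card_add]; omega) S' rfl
      refine ⟨X ::ₘ B, R, by rw [join_cons, add_assoc], ?_, hR⟩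
      intro Z hZ
      rcases mem_cons.1 hZ with rfl | hZ
      · refine ⟨hcard, ?_⟩
        rw [map_multiset_sum, hXc]
        simpa using two_nsmul_class v
      · exact hB Z hZ

theorem map_sum_join_eq_zero {B : Multiset (Multiset G)} {t : ℕ} (hB : ∀ X ∈ B, IsBlock c t X) :
    c B.join.sum = 0 := by
  rw [sum_join, map_multiset_sum, Multiset.map_map]
  refine sum_eq_zero fun x hx => ?_
  obtain ⟨X, hX, rfl⟩ := mem_map.1 hx
  exact (hB X hX).2

/-- A quadruple with sum in the kernel acts, together with `2 * n - 3` pairs, like the pair that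
completes them to an extremal sequence. -/
theorem zeroSumFreeAt_cons_of_quad (hn : 2 ≤ n) (hS : ZeroSumFreeAt (2 * n) S)
    {B : Multiset (Multiset G)} (hB : ∀ X ∈ B, IsBlock c 2 X) (hcard : card B + 1 = 2 * (n - 1))
    {Q : Multiset G} (hQ : card Q = 4) (hle : Q + B.join ≤ S) :
    ZeroSumFreeAt n (-(B.join.sum + Q.sum) ::ₘ B.map sum) := by
  classical
  have hfree := hS.map_sum (fun X hX => (hB X hX).1) ((le_add_left _ _).trans hle)
  intro U hU hUc hUs
  -- If U uses the extra element, the n - 2 pairs outside U together with Q have sum zero and total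
  -- length 2(n - 2) + 4 = 2n.
  by_cases hx : -(B.join.sum + Q.sum) ∈ U
  · obtain ⟨U', rfl⟩ := exists_cons_of_mem hx
    obtain ⟨W, hW⟩ := Multiset.le_iff_exists_add.1 ((cons_le_cons_iff _).1 hU)
    have hWle : W ≤ B.map sum := hW ▸ le_add_left _ _
    have hWc : card W = n - 2 := by
      have := congrArg card hW
      simp at this hUc
      omega
    have hWs : Q.sum + W.sum = 0 := by
      have h1 := congrArg sum hW
      rw [← sum_join, sum_add] at h1
      rw [sum_cons, h1] at hUs
      rw [← neg_eq_zero, ← hUs]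
      abel
    obtain ⟨B', hB', rfl⟩ := exists_le_map_eq sum B hWle
    refine hS (Q + B'.join) ((add_le_add_right (join_le_join hB') _).trans hle) ?_ ?_
    · rw [card_add, hQ, card_join_of_forall fun X hX => (hB X (mem_of_le hB' hX)).1]
      rw [card_map] at hWc
      omega
    · rw [sum_add, sum_join, hWs]
  · exact hfree U ((le_cons_of_notMem hx).1 hU) hUc hUs

variable (hn : 2 ≤ n) (he : addOrderOf e = n)
  (hker : ∀ x, c x = 0 → x ∈ AddSubgroup.zmultiples e) (hS : ZeroSumFreeAt (2 * n) S)

include hn he hker hS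

theorem sum_quad_eq {B : Multiset (Multiset G)} (hB : ∀ X ∈ B, IsBlock c 2 X)
    (hcard : card B + 1 = 2 * (n - 1)) {Q Q' : Multiset G} (hQ : IsBlock c 4 Q)
    (hQ' : IsBlock c 4 Q') (hle : Q + B.join ≤ S) (hle' : Q' + B.join ≤ S) : Q.sum = Q'.sum := by
  have hBs := map_sum_join_eq_zero hB
  have := eq_of_zeroSumFreeAt_cons he hn (inverseEGZ n) (mem_zmultiples_of_mem_map_sum hker hB)
    (by simpa using hcard) (hker _ (by rw [map_neg, _root_.map_add, hBs, hQ.2]; simp)) (hker _ (by rw [map_neg, _root_.map_add, hBs, hQ'.2]; simp))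
    (zeroSumFreeAt_cons_of_quad hn hS hB hcard hQ.1 hle)
    (zeroSumFreeAt_cons_of_quad hn hS hB hcard hQ'.1 hle')
  simpa using this

theorem sum_pair_eq_of_quad {B : Multiset (Multiset G)} (hB : ∀ X ∈ B, IsBlock c 2 X)
    (hcard : card B + 1 = 2 * (n - 1)) {X Q : Multiset G} (hX : IsBlock c 2 X)
    (hQ : IsBlock c 4 Q) (hXle : X + B.join ≤ S) (hle : Q + B.join ≤ S) :
    X.sum = -(B.join.sum + Q.sum) := by
  have hBs := map_sum_join_eq_zero hB
  refine eq_of_zeroSumFreeAt_cons he hn (inverseEGZ n) (mem_zmultiples_of_mem_map_sum hker hB)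
    (by simpa using hcard) (hker _ hX.2) (hker _ (by rw [map_neg, _root_.map_add, hBs, hQ.2]; simp)) ?_
    (zeroSumFreeAt_cons_of_quad hn hS hB hcard hQ.1 hle)
  rw [← map_cons]
  refine hS.map_sum ?_ (by rwa [join_cons])
  intro Z hZ
  rcases mem_cons.1 hZ with rfl | hZ
  exacts [hX.1, (hB Z hZ).1]

/-- If one element is taken from each of the eight classes, then their doubles agree. -/
theorem exists_double_eq_of_transversal {B : Multiset (Multiset G)} {R : Multiset G}
    (hB : ∀ X ∈ B, IsBlock c 2 X) (hcard : card B + 1 = 2 * (n - 1)) (hSB : B.join + R ≤ S)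
    (hR : ∀ v, ∃ x ∈ R, c x = v) (hRn : (R.map c).Nodup) :
    ∃ d, (∀ x ∈ R, x + x = d) ∧ ∀ Q ≤ R, IsBlock c 4 Q → Q.sum = d + d := by
  have hquad : ∀ Q ≤ R, ∀ Q' ≤ R, IsBlock c 4 Q → IsBlock c 4 Q' → Q.sum = Q'.sum := by
    intro Q hQ Q' hQ' h h'
    refine sum_quad_eq hn he hker hS hB hcard h h' ?_ ?_ <;>
    · rw [add_comm]
      exact (add_le_add_right (by assumption) _).trans hSB
  have hinj := inj_on_of_nodup_map hRn
  -- Any two of three parallel lines span a plane. Adding the two plane sums through the line of x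
  -- and y and subtracting the third leaves 2x + 2y.
  have hadd : ∀ x ∈ R, ∀ y ∈ R, x ≠ y → (∀ Q ≤ R, IsBlock c 4 Q → Q.sum = (x + x) + (y + y)) ∧
      ∃ z ∈ R, z ≠ x ∧ z ≠ y := by
    intro x hx y hy hxy
    obtain ⟨u, v, huv⟩ := exists_frame (c x) (c y) fun h => hxy (hinj x hx y hy h)
    obtain ⟨x₁, hx₁, ex₁⟩ := hR (c x + u)
    obtain ⟨y₁, hy₁, ey₁⟩ := hR (c y + u)
    obtain ⟨x₂, hx₂, ex₂⟩ := hR (c x + v)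
    obtain ⟨y₂, hy₂, ey₂⟩ := hR (c y + v)
    rw [← ex₁, ← ey₁, ← ex₂, ← ey₂] at huv
    have hle : ({x, y, x₁, y₁, x₂, y₂} : Multiset G) ≤ R := by
      refine (le_iff_subset (Nodup.of_map c ?_)).2 ?_
      · have : [c x, c y, c x₁, c y₁, c x₂, c y₂].Nodup := by
          simp only [List.nodup_cons, List.mem_cons, not_or] at huv ⊢
          tauto
        exact this
      · intro z hz
        simp only [insert_eq_cons, mem_cons, mem_singleton] at hz
        rcases hz with rfl | rfl | rfl | rfl | rfl | rfl <;> assumption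
    have key : ∀ a b a' b' : G, ({a, b, a', b'} : Multiset G) ≤ R → c a + c b + c a' + c b' = 0 →
        ∀ Q ≤ R, IsBlock c 4 Q → Q.sum = a + b + a' + b' := by
      intro a b a' b' h1 h2 Q hQ hb
      rw [hquad Q hQ _ h1 hb ⟨by simp, by simpa [add_assoc] using h2⟩]
      simp [add_assoc]
    have h2 : ∀ a b w : ZMod 2 × ZMod 2 × ZMod 2, a + b + (a + w) + (b + w) = 0 := by
      intro a b w
      rw [← two_nsmul_class (a + b + w)]; abel
    have h3 : ∀ a b w w' : ZMod 2 × ZMod 2 × ZMod 2,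
        (a + w) + (b + w) + (a + w') + (b + w') = 0 := by
      intro a b w w'
      rw [← two_nsmul_class (a + b + w + w')]; abel
    have k₁ := key x y x₁ y₁ (le_trans (Multiset.le_iff_exists_add.2 ⟨{x₂, y₂}, by
      simp only [insert_eq_cons, ← singleton_add]; abel⟩) hle) (by rw [ex₁, ey₁]; exact h2 _ _ _)
    have k₂ := key x y x₂ y₂ (le_trans (Multiset.le_iff_exists_add.2 ⟨{x₁, y₁}, by
      simp only [insert_eq_cons, ← singleton_add]; abel⟩) hle) (by rw [ex₂, ey₂]; exact h2 _ _ _)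
    have k₃ := key x₁ y₁ x₂ y₂ (le_trans (Multiset.le_iff_exists_add.2 ⟨{x, y}, by
      simp only [insert_eq_cons, ← singleton_add]; abel⟩) hle)
      (by rw [ex₁, ex₂, ey₁, ey₂]; exact h3 _ _ _ _)
    refine ⟨fun Q hQ hb => ?_, x₁, hx₁, ?_, ?_⟩
    · have e₁ := k₁ Q hQ hb
      have e₂ := k₂ Q hQ hb
      have e₃ := k₃ Q hQ hb
      calc Q.sum = Q.sum + Q.sum - Q.sum := by abel
        _ = (x + y + x₁ + y₁) + (x + y + x₂ + y₂) - (x₁ + y₁ + x₂ + y₂) := by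
          rw [← e₁, ← e₂, ← e₃]
        _ = _ := by abel
    · rintro rfl
      simp at huv
    · rintro rfl
      simp at huv
  obtain ⟨x₀, hx₀, -⟩ := hR 0
  have hquad_ex : ∃ Q ≤ R, IsBlock c 4 Q := by
    obtain ⟨a₀, h₀, e₀⟩ := hR (0, 0, 0)
    obtain ⟨a₁, h₁, e₁⟩ := hR (0, 0, 1)
    obtain ⟨a₂, h₂, e₂⟩ := hR (0, 1, 0)
    obtain ⟨a₃, h₃, e₃⟩ := hR (0, 1, 1)
    refine ⟨{a₀, a₁, a₂, a₃}, (le_iff_subset (Nodup.of_map c ?_)).2 ?_, by simp, ?_⟩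
    · simp only [insert_eq_cons, map_cons, map_singleton, e₀, e₁, e₂, e₃]
      decide
    · intro z hz
      simp only [insert_eq_cons, mem_cons, mem_singleton] at hz
      rcases hz with rfl | rfl | rfl | rfl <;> assumption
    · simp only [insert_eq_cons, sum_cons, sum_singleton, _root_.map_add, e₀, e₁, e₂, e₃]
      decide
  obtain ⟨Q₀, hQ₀, hb₀⟩ := hquad_ex
  have hdouble : ∀ x ∈ R, ∀ y ∈ R, x + x = y + y := by
    intro x hx y hy
    by_cases hxy : x = y
    · rw [hxy]
    · obtain ⟨-, z, hz, hzx, hzy⟩ := hadd x hx y hy hxy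
      have e₁ := (hadd x hx z hz hzx.symm).1 Q₀ hQ₀ hb₀
      have e₂ := (hadd y hy z hz hzy.symm).1 Q₀ hQ₀ hb₀
      exact add_right_cancel (e₁.symm.trans e₂)
  refine ⟨x₀ + x₀, fun x hx => hdouble x hx x₀ hx₀, fun Q hQ hb => ?_⟩
  obtain ⟨y, hy, hcy⟩ := hR (c x₀ + (1, 0, 0))
  have hne : x₀ ≠ y := by
    rintro rfl
    simp at hcy
  rw [(hadd x₀ hx₀ y hy hne).1 Q hQ hb, hdouble y hy x₀ hx₀]

end

/-! ### Structure of sequences of length 4n + 2 -/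

theorem exists_join_eq_replicate {G : Type*} {B : Multiset (Multiset G)} {f f₂ f₃ : G}
    (hB : ∀ X ∈ B, X = {f, f} ∨ X = {f₂, f₂} ∨ X = {f₃, f₃}) :
    ∃ u v w, u + v + w = card B ∧ B.join =
      replicate (2 * u) f + replicate (2 * v) f₂ + replicate (2 * w) f₃ := by
  induction B using Multiset.induction_on with
  | empty => exact ⟨0, 0, 0, by simp, by simp⟩
  | cons X B ih =>
    obtain ⟨u, v, w, h1, h2⟩ := ih fun Z hZ => hB Z (mem_cons_of_mem hZ)
    have hpair : ∀ (k : ℕ) (x : G), replicate (2 * (k + 1)) x = {x, x} + replicate (2 * k) x := by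
      intro k x
      rw [mul_add, replicate_add, add_comm]
      rfl
    rcases hB X (mem_cons_self X B) with rfl | rfl | rfl
    · refine ⟨u + 1, v, w, by rw [card_cons]; omega, ?_⟩
      rw [join_cons, h2, hpair]
      abel
    · refine ⟨u, v + 1, w, by rw [card_cons]; omega, ?_⟩
      rw [join_cons, h2, hpair]
      abel
    · refine ⟨u, v, w + 1, by rw [card_cons]; omega, ?_⟩
      rw [join_cons, h2, hpair]
      abel

section

variable {G : Type*} [AddCommGroup G] {c : G →+ ZMod 2 × ZMod 2 × ZMod 2} {e : G} {n : ℕ}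
  {S : Multiset G}

theorem nsmul_eq_zero_of_mem_zmultiples (he : addOrderOf e = n) {x : G}
    (hx : x ∈ AddSubgroup.zmultiples e) : n • x = 0 := by
  obtain ⟨k, rfl⟩ := hx
  change n • k • e = 0
  rw [smul_comm, ← he, addOrderOf_nsmul_eq_zero, smul_zero]

/-- Otherwise g^2 h^(n-2) would have the same sum as h^n, namely zero; n ≥ 3 ensures that g is
available twice. -/
theorem add_self_ne_of_extremal (hn : 3 ≤ n) {P : Multiset G} {g h : G} (hg : n • h = 0)
    (hP : P = replicate (n - 1) g + replicate (n - 1) h) (hfree : ZeroSumFreeAt n P) :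
    g + g ≠ h + h := by
  intro hgh
  refine hfree (replicate 2 g + replicate (n - 2) h) ?_ ?_ ?_
  · rw [hP]
    exact add_le_add ((replicate_le_replicate _).2 (by omega))
      ((replicate_le_replicate _).2 (by omega))
  · simp
    omega
  · rw [sum_add, sum_replicate, sum_replicate, two_nsmul, hgh, ← two_nsmul, ← add_nsmul, ← hg]
    congr 1
    omega

variable (hn : 2 ≤ n) (he : addOrderOf e = n)
  (hker : ∀ x, c x = 0 → x ∈ AddSubgroup.zmultiples e) (hS : ZeroSumFreeAt (2 * n) S)

include hn he hker hS

/-- All terms turn out to have the same double d, so twice any pair sum is 2d, which is also the sum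
of any quadruple taken from `R`. The extremal sequence given by a quadruple then has values g and h
with equal doubles, which is impossible. -/
theorem false_of_card_eq_eight {B : Multiset (Multiset G)} {R : Multiset G}
    (hB : ∀ X ∈ B, IsBlock c 2 X) (hcard : card B + 1 = 2 * (n - 1)) (hSB : S = B.join + R)
    (hRn : (R.map c).Nodup) (hRc : card R = 8) : False := by
  classical
  have hRv : ∀ (R : Multiset G), (R.map c).Nodup → card R = 8 → ∀ v, ∃ x ∈ R, c x = v := by
    intro R h1 h2 v
    have : (⟨R.map c, h1⟩ : Finset _) = Finset.univ :=
      Finset.eq_univ_of_card _ (by rw [Finset.card_mk, card_map, h2]; rfl)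
    have hv : v ∈ (⟨R.map c, h1⟩ : Finset _) := this ▸ Finset.mem_univ v
    exact mem_map.1 hv
  obtain ⟨d, hd, hQ⟩ := exists_double_eq_of_transversal hn he hker hS hB hcard hSB.ge
    (hRv R hRn hRc) hRn
  have hpair : ∀ a b, {a, b} ∈ B → a + a = d := by
    intro a b hX
    obtain ⟨B', rfl⟩ := exists_cons_of_mem hX
    obtain ⟨r, hr, hcr⟩ := hRv R hRn hRc (c a)
    obtain ⟨R', rfl⟩ := exists_cons_of_mem hr
    have hab := (hB _ hX).2
    -- Swapping a with the representative r of its class gives another transversal; it shares seven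
    -- terms with `R`, so its common double is again d.
    obtain ⟨d', hd', -⟩ := exists_double_eq_of_transversal (B := {r, b} ::ₘ B') (R := a ::ₘ R')
      hn he hker hS
      (by
        intro Z hZ
        rcases mem_cons.1 hZ with rfl | hZ
        · exact ⟨by simp, by simpa [hcr] using hab⟩
        · exact hB Z (mem_cons_of_mem hZ))
      (by simpa using hcard)
      (by
        rw [hSB]
        refine le_of_eq ?_
        simp only [join_cons]
        simp only [insert_eq_cons, ← singleton_add]
        abel)
      (hRv _ (by simpa [hcr] using hRn) (by simpa using hRc)) (by simpa [hcr] using hRn)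
    obtain ⟨y, hy⟩ := card_pos_iff_exists_mem.1 (by simp at hRc; omega : 0 < card R')
    rw [hd' a (by simp), ← hd' y (by simp [hy]), hd y (by simp [hy])]
  have hsum : ∀ p ∈ B.map sum, p + p = d + d := by
    intro p hp
    obtain ⟨X, hX, rfl⟩ := mem_map.1 hp
    obtain ⟨a, b, rfl⟩ := card_eq_two.1 (hB X hX).1
    have h1 := hpair a b hX
    have h2 := hpair b a (by rwa [pair_comm])
    simp only [insert_eq_cons, sum_cons, sum_singleton]
    rw [add_add_add_comm, h1, h2]
  obtain ⟨a₀, h₀, e₀⟩ := hRv R hRn hRc (0, 0, 0)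
  obtain ⟨a₁, h₁, e₁⟩ := hRv R hRn hRc (0, 0, 1)
  obtain ⟨a₂, h₂, e₂⟩ := hRv R hRn hRc (0, 1, 0)
  obtain ⟨a₃, h₃, e₃⟩ := hRv R hRn hRc (0, 1, 1)
  have hQle : ({a₀, a₁, a₂, a₃} : Multiset G) ≤ R := by
    refine (le_iff_subset (Nodup.of_map c ?_)).2 ?_
    · simp only [insert_eq_cons, map_cons, map_singleton, e₀, e₁, e₂, e₃]
      decide
    · intro z hz
      simp only [insert_eq_cons, mem_cons, mem_singleton] at hz
      rcases hz with rfl | rfl | rfl | rfl <;> assumption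
  have hQb : IsBlock c 4 ({a₀, a₁, a₂, a₃} : Multiset G) := by
    refine ⟨by simp, ?_⟩
    simp only [insert_eq_cons, sum_cons, sum_singleton, _root_.map_add, e₀, e₁, e₂, e₃]
    decide
  have hfree := zeroSumFreeAt_cons_of_quad hn hS hB hcard hQb.1
    (by rw [hSB, add_comm]; exact add_le_add_right hQle _)
  rw [hQ _ hQle hQb] at hfree
  have hmem : ∀ x ∈ -(B.join.sum + (d + d)) ::ₘ B.map sum, x ∈ AddSubgroup.zmultiples e := by
    intro x hx
    rcases mem_cons.1 hx with rfl | hx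
    · refine hker _ ?_
      rw [map_neg, _root_.map_add, map_sum_join_eq_zero hB, ← hQ _ hQle hQb, hQb.2]
      simp
    · exact mem_zmultiples_of_mem_map_sum hker hB x hx
  -- For n = 2 there is a single pair, of sum p with 2p = 0, and the two-term sequence has sum -2d =
  -- -2p = 0.
  rcases hn.eq_or_lt with rfl | hn3
  · obtain ⟨X, rfl⟩ := card_eq_one.1 (by omega : card B = 1)
    have hp := hsum X.sum (by simp)
    have hp' := nsmul_eq_zero_of_mem_zmultiples he (hmem X.sum (by simp))
    rw [two_nsmul] at hp'
    refine hfree _ le_rfl (by simp) ?_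
    simp [← hp, hp']
  · obtain ⟨g, h, hP⟩ := hfree.eq_replicate_add he (inverseEGZ n) hmem (by simpa using hcard)
    -- A value of multiplicity at least two still occurs among the pair sums once the adjoined
    -- element is discarded.
    have hdd : ∀ x, 2 ≤ count x (-(B.join.sum + (d + d)) ::ₘ B.map sum) → x + x = d + d := by
      intro x hx
      refine hsum x (count_pos.1 ?_)
      rw [count_cons] at hx
      split_ifs at hx <;> omega
    have hgm : g ∈ -(B.join.sum + (d + d)) ::ₘ B.map sum := by
      rw [hP]; simp [mem_replicate]; omega
    have hhm : h ∈ -(B.join.sum + (d + d)) ::ₘ B.map sum := by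
      rw [hP]; simp [mem_replicate]; omega
    refine add_self_ne_of_extremal hn3 (nsmul_eq_zero_of_mem_zmultiples he (hmem h hhm)) hP hfree ?_
    rw [hdd g (by rw [hP]; simp; omega), hdd h (by rw [hP]; simp; omega)]

omit hn he hker hS in
-- Here a and b lie in one class missing from the leftovers. The first four equations come from the
-- planes through a that meet each couple once, the last three from the planes spanned by two
-- couples; their difference isolates 4a, while `hb` gives b = a.
theorem eq_of_planes {a b x₁ y₁ x₂ y₂ x₃ y₃ q : G} (h₁ : a + x₁ + x₂ + x₃ = q)
    (h₂ : a + y₁ + y₂ + x₃ = q) (h₃ : a + y₁ + x₂ + y₃ = q) (h₄ : a + x₁ + y₂ + y₃ = q)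
    (hb : b + x₁ + x₂ + x₃ = q) (h₁₂ : x₁ + y₁ + x₂ + y₂ = q) (h₁₃ : x₁ + y₁ + x₃ + y₃ = q)
    (h₂₃ : x₂ + y₂ + x₃ + y₃ = q) : (a + b) + (a + b) = q := by
  have hab : b = a := by
    rw [← h₁] at hb
    simpa using hb
  rw [hab]
  calc a + a + (a + a) = (a + x₁ + x₂ + x₃) + (a + y₁ + y₂ + x₃) + (a + y₁ + x₂ + y₃) +
        (a + x₁ + y₂ + y₃) - (x₁ + y₁ + x₂ + y₂) - (x₁ + y₁ + x₃ + y₃) -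
        (x₂ + y₂ + x₃ + y₃) := by abel
    _ = q := by
      rw [h₁, h₂, h₃, h₄, h₁₂, h₁₃, h₂₃]
      abel

omit hn he hker hS in
theorem exists_eq_six {R : Multiset G} (hRn : (R.map c).Nodup) (hRc : card R = 6) :
    ∃ α β u v x₁ y₁ x₂ y₂ x₃ y₃,
      [α, β, α + u, β + u, α + v, β + v, α + (u + v), β + (u + v)].Nodup ∧
      R = {x₁, y₁, x₂, y₂, x₃, y₃} ∧ c x₁ = α + u ∧ c y₁ = β + u ∧ c x₂ = α + v ∧
      c y₂ = β + v ∧ c x₃ = α + (u + v) ∧ c y₃ = β + (u + v) := by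
  classical
  have hF : ((⟨R.map c, hRn⟩ : Finset _)ᶜ).card = 2 := by
    rw [Finset.card_compl, Finset.card_mk, card_map, hRc]
    rfl
  obtain ⟨α, β, hαβ, hFe⟩ := Finset.card_eq_two.1 hF
  obtain ⟨u, v, huv⟩ := exists_frame α β hαβ
  have hex : ∀ w, w ≠ α → w ≠ β → ∃ x ∈ R, c x = w := by
    intro w h1 h2
    have : w ∉ (⟨R.map c, hRn⟩ : Finset _)ᶜ := by
      rw [hFe]
      simp [h1, h2]
    rw [Finset.mem_compl, not_not] at this
    exact mem_map.1 this
  have huv' := huv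
  simp only [List.nodup_cons, List.mem_cons, not_or, List.not_mem_nil, not_false_eq_true,
    and_true] at huv'
  obtain ⟨x₁, hx₁, ex₁⟩ := hex (α + u) (by tauto) (by tauto)
  obtain ⟨y₁, hy₁, ey₁⟩ := hex (β + u) (by tauto) (by tauto)
  obtain ⟨x₂, hx₂, ex₂⟩ := hex (α + v) (by tauto) (by tauto)
  obtain ⟨y₂, hy₂, ey₂⟩ := hex (β + v) (by tauto) (by tauto)
  obtain ⟨x₃, hx₃, ex₃⟩ := hex (α + (u + v)) (by tauto) (by tauto)
  obtain ⟨y₃, hy₃, ey₃⟩ := hex (β + (u + v)) (by tauto) (by tauto)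
  refine ⟨α, β, u, v, x₁, y₁, x₂, y₂, x₃, y₃, huv, ?_, ex₁, ey₁, ex₂, ey₂, ex₃, ey₃⟩
  refine (eq_of_le_of_card_le ((le_iff_subset (Nodup.of_map c ?_)).2 ?_) (by simp [hRc])).symm
  · have : [c x₁, c y₁, c x₂, c y₂, c x₃, c y₃].Nodup := by
      rw [ex₁, ey₁, ex₂, ey₂, ex₃, ey₃]
      exact (List.nodup_cons.1 (List.nodup_cons.1 huv).2).2
    exact this
  · intro z hz
    simp only [insert_eq_cons, mem_cons, mem_singleton] at hz
    rcases hz with rfl | rfl | rfl | rfl | rfl | rfl <;> assumption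

/-- When six classes have odd multiplicity, the elements left over by the pairs come in three
couples, no pair lies outside their classes, and each pair repeats a left-over element. -/
theorem exists_couples_of_card_eq_six {B : Multiset (Multiset G)} {R : Multiset G}
    (hB : ∀ X ∈ B, IsBlock c 2 X) (hcard : card B = 2 * (n - 1)) (hSB : S = B.join + R)
    (hRn : (R.map c).Nodup) (hRc : card R = 6) :
    ∃ g h x₁ y₁ x₂ y₂ x₃ y₃, g ≠ h ∧ B.map sum = replicate (n - 1) g + replicate (n - 1) h ∧
      R = {x₁, y₁, x₂, y₂, x₃, y₃} ∧ (x₁ + x₁) + (y₁ + y₁) = g + h ∧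
      (x₂ + x₂) + (y₂ + y₂) = g + h ∧ (x₃ + x₃) + (y₃ + y₃) = g + h ∧
      ∀ X ∈ B, ∃ r ∈ R, X = {r, r} := by
  classical
  have hmem := mem_zmultiples_of_mem_map_sum hker hB
  have hfree := hS.map_sum (fun X hX => (hB X hX).1) (hSB ▸ le_add_right _ _)
  obtain ⟨g, h, hP⟩ := hfree.eq_replicate_add he (inverseEGZ n) hmem (by simpa using hcard)
  have hn0 : n - 1 ≠ 0 := by omega
  have hgm : g ∈ B.map sum := by rw [hP]; simp [mem_replicate, hn0]
  have hhm : h ∈ B.map sum := by rw [hP]; simp [mem_replicate, hn0]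
  have hg := nsmul_eq_zero_of_mem_zmultiples he (hmem g hgm)
  have hh := nsmul_eq_zero_of_mem_zmultiples he (hmem h hhm)
  have hgh : g ≠ h := by
    rintro rfl
    have := count_lt_of_zeroSumFreeAt hfree g hg
    rw [hP] at this
    simp at this
    omega
  have htotal : B.join.sum + (g + h) = 0 := by
    rw [sum_join, hP, sum_add, sum_replicate, sum_replicate, ← nsmul_add, ← succ_nsmul,
      Nat.sub_add_cancel (by omega), nsmul_add, hg, hh, add_zero]
  -- The pair X and the completion determined by Q coincide, and all pairs together sum to -(g + h).
  have hquad : ∀ X ∈ B, ∀ Q ≤ X + R, IsBlock c 4 Q → Q.sum = g + h := by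
    intro X hX Q hQ hb
    obtain ⟨B', rfl⟩ := exists_cons_of_mem hX
    have := sum_pair_eq_of_quad hn he hker hS (fun Z hZ => hB Z (mem_cons_of_mem hZ))
      (by simpa using hcard) (hB X hX) hb (by rw [hSB, join_cons]; exact le_add_right _ _)
      (by rw [hSB, join_cons, add_right_comm]; exact add_le_add_left hQ _)
    rw [join_cons, sum_add, this] at htotal
    rw [← sub_eq_zero, ← neg_eq_zero, ← htotal]
    abel
  have hpair : ∀ X ∈ B, ∀ Y ≤ X + R, IsBlock c 2 Y → Y.sum = X.sum := by
    intro X hX Y hY hb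
    obtain ⟨B', rfl⟩ := exists_cons_of_mem hX
    exact sum_eq_of_blocks he hn (inverseEGZ n) hker hS (fun Z hZ => hB Z (mem_cons_of_mem hZ))
      (by simpa using hcard) hb (hB X hX)
      (by rw [hSB, join_cons, add_right_comm]; exact add_le_add_left hY _)
      (by rw [hSB, join_cons]; exact le_add_right _ _)
  obtain ⟨α, β, u, v, x₁, y₁, x₂, y₂, x₃, y₃, huv, hR, ex₁, ey₁, ex₂, ey₂, ex₃, ey₃⟩ :=
    exists_eq_six hRn hRc
  have key : ∀ X ∈ B, ∀ a b a' b' T, {a, b, a', b'} + T = X + R → c a + c b + c a' + c b' = 0 →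
      a + b + a' + b' = g + h := by
    intro X hX a b a' b' T h1 h2
    rw [← hquad X hX {a, b, a', b'} (h1 ▸ le_add_right _ _)
      ⟨by simp, by simpa [add_assoc] using h2⟩]
    simp [add_assoc]
  have hz1 : ∀ a b w w' : ZMod 2 × ZMod 2 × ZMod 2,
      (a + w) + (b + w) + (a + w') + (b + w') = 0 := by
    intro a b w w'
    rw [← two_nsmul_class (a + b + w + w')]; abel
  have hz2 : ∀ a w w' : ZMod 2 × ZMod 2 × ZMod 2, a + (a + w) + (a + w') + (a + (w + w')) = 0 := by
    intro a w w'
    rw [← two_nsmul_class (a + a + w + w')]; abel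
  have hz3 : ∀ a b w w' : ZMod 2 × ZMod 2 × ZMod 2,
      a + (b + w) + (b + w') + (a + (w + w')) = 0 := by
    intro a b w w'
    rw [← two_nsmul_class (a + b + w + w')]; abel
  have hz4 : ∀ a b w w' : ZMod 2 × ZMod 2 × ZMod 2,
      a + (b + w) + (a + w') + (b + (w + w')) = 0 := by
    intro a b w w'
    rw [← two_nsmul_class (a + b + w + w')]; abel
  have hz5 : ∀ a b w w' : ZMod 2 × ZMod 2 × ZMod 2,
      a + (a + w) + (b + w') + (b + (w + w')) = 0 := by
    intro a b w w'
    rw [← two_nsmul_class (a + b + w + w')]; abel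
  obtain ⟨X₀, hX₀⟩ := card_pos_iff_exists_mem.1 (by omega : 0 < card B)
  have h₁₂ : x₁ + y₁ + x₂ + y₂ = g + h := key X₀ hX₀ _ _ _ _ (X₀ + {x₃, y₃})
    (by simp only [hR, insert_eq_cons, ← singleton_add]; abel)
    (by rw [ex₁, ex₂, ey₁, ey₂]; exact hz1 _ _ _ _)
  have h₁₃ : x₁ + y₁ + x₃ + y₃ = g + h := key X₀ hX₀ _ _ _ _ (X₀ + {x₂, y₂})
    (by simp only [hR, insert_eq_cons, ← singleton_add]; abel)
    (by rw [ex₁, ex₃, ey₁, ey₃]; exact hz1 _ _ _ _)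
  have h₂₃ : x₂ + y₂ + x₃ + y₃ = g + h := key X₀ hX₀ _ _ _ _ (X₀ + {x₁, y₁})
    (by simp only [hR, insert_eq_cons, ← singleton_add]; abel)
    (by rw [ex₂, ex₃, ey₂, ey₃]; exact hz1 _ _ _ _)
  have hsum : ∀ X ∈ B, X.sum + X.sum ≠ g + h := by
    intro X hX hXs
    have : X.sum ∈ B.map sum := mem_map_of_mem _ hX
    rw [hP, mem_add] at this
    rcases this with this | this <;> rw [eq_of_mem_replicate this] at hXs
    · exact hgh (add_left_cancel hXs)
    · exact hgh (add_right_cancel hXs).symm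
  refine ⟨g, h, x₁, y₁, x₂, y₂, x₃, y₃, hgh, hP, hR, ?_, ?_, ?_, ?_⟩
  · calc x₁ + x₁ + (y₁ + y₁) = (x₁ + y₁ + x₂ + y₂) + (x₁ + y₁ + x₃ + y₃) -
          (x₂ + y₂ + x₃ + y₃) := by abel
      _ = g + h := by rw [h₁₂, h₁₃, h₂₃]; abel
  · calc x₂ + x₂ + (y₂ + y₂) = (x₁ + y₁ + x₂ + y₂) + (x₂ + y₂ + x₃ + y₃) -
          (x₁ + y₁ + x₃ + y₃) := by abel
      _ = g + h := by rw [h₁₂, h₁₃, h₂₃]; abel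
  · calc x₃ + x₃ + (y₃ + y₃) = (x₁ + y₁ + x₃ + y₃) + (x₂ + y₂ + x₃ + y₃) -
          (x₁ + y₁ + x₂ + y₂) := by abel
      _ = g + h := by rw [h₁₂, h₁₃, h₂₃]; abel
  · intro X hX
    obtain ⟨a, b, rfl⟩ := card_eq_two.1 (hB X hX).1
    have hab : c a = c b := class_eq_of_add_eq_zero (by simpa using (hB _ hX).2)
    -- If a leftover r shares the class of the pair, then {r, a} and {r, b} can replace {a, b}, so r
    -- = b and r = a. Otherwise the class is one of the two missing ones, and the plane equations
    -- give 2(a + b) = g + h, although a + b is g or h.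
    by_cases hr : ∃ r ∈ R, c r = c a
    · obtain ⟨r, hr, hcr⟩ := hr
      obtain ⟨R', hR'⟩ := exists_cons_of_mem hr
      have h1 := hpair _ hX {r, a} (Multiset.le_iff_exists_add.2 ⟨b ::ₘ R', by
        rw [hR']; simp only [insert_eq_cons, ← singleton_add]; abel⟩)
        ⟨by simp, by simpa [hcr] using two_nsmul_class (c a)⟩
      have h2 := hpair _ hX {r, b} (Multiset.le_iff_exists_add.2 ⟨a ::ₘ R', by
        rw [hR']; simp only [insert_eq_cons, ← singleton_add]; abel⟩)
        ⟨by simp, by simpa [hcr, hab] using two_nsmul_class (c b)⟩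
      simp only [insert_eq_cons, sum_cons, sum_singleton] at h1 h2
      rw [add_comm a b] at h1
      obtain rfl := add_right_cancel h1
      obtain rfl := add_right_cancel h2
      exact ⟨r, hr, rfl⟩
    · exfalso
      have hca : c a = α ∨ c a = β := by
        have := mem_frame α β u v (c a) huv
        rw [← ex₁, ← ey₁, ← ex₂, ← ey₂, ← ex₃, ← ey₃] at this
        by_contra hcon
        simp only [List.mem_cons, List.not_mem_nil, or_false] at this
        rw [hR] at hr
        simp at hr
        grind
      have hs := hsum _ hX
      simp only [insert_eq_cons, sum_cons, sum_singleton] at hs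
      rcases hca with hα | hβ
      · have hcb := hab ▸ hα
        refine hs (eq_of_planes (a := a) (b := b) (x₁ := x₁) (y₁ := y₁) (x₂ := x₂) (y₂ := y₂)
          (x₃ := x₃) (y₃ := y₃) ?_ ?_ ?_ ?_ ?_ h₁₂ h₁₃ h₂₃)
        · exact key _ hX _ _ _ _ {b, y₁, y₂, y₃}
            (by simp only [hR, insert_eq_cons, ← singleton_add]; abel)
            (by rw [hα, ex₁, ex₂, ex₃]; exact hz2 _ _ _)
        · exact key _ hX _ _ _ _ {b, x₁, x₂, y₃}
            (by simp only [hR, insert_eq_cons, ← singleton_add]; abel)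
            (by rw [hα, ey₁, ey₂, ex₃]; exact hz3 _ _ _ _)
        · exact key _ hX _ _ _ _ {b, x₁, y₂, x₃}
            (by simp only [hR, insert_eq_cons, ← singleton_add]; abel)
            (by rw [hα, ey₁, ex₂, ey₃]; exact hz4 _ _ _ _)
        · exact key _ hX _ _ _ _ {b, y₁, x₂, x₃}
            (by simp only [hR, insert_eq_cons, ← singleton_add]; abel)
            (by rw [hα, ex₁, ey₂, ey₃]; exact hz5 _ _ _ _)
        · exact key _ hX _ _ _ _ {a, y₁, y₂, y₃}
            (by simp only [hR, insert_eq_cons, ← singleton_add]; abel)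
            (by rw [hcb, ex₁, ex₂, ex₃]; exact hz2 _ _ _)
      · have hcb := hab ▸ hβ
        refine hs (eq_of_planes (a := a) (b := b) (x₁ := y₁) (y₁ := x₁) (x₂ := y₂) (y₂ := x₂)
          (x₃ := y₃) (y₃ := x₃) ?_ ?_ ?_ ?_ ?_ (by rw [← h₁₂]; abel) (by rw [← h₁₃]; abel)
          (by rw [← h₂₃]; abel))
        · exact key _ hX _ _ _ _ {b, x₁, x₂, x₃}
            (by simp only [hR, insert_eq_cons, ← singleton_add]; abel)
            (by rw [hβ, ey₁, ey₂, ey₃]; exact hz2 _ _ _)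
        · exact key _ hX _ _ _ _ {b, y₁, y₂, x₃}
            (by simp only [hR, insert_eq_cons, ← singleton_add]; abel)
            (by rw [hβ, ex₁, ex₂, ey₃]; exact hz3 _ _ _ _)
        · exact key _ hX _ _ _ _ {b, y₁, x₂, y₃}
            (by simp only [hR, insert_eq_cons, ← singleton_add]; abel)
            (by rw [hβ, ex₁, ey₂, ex₃]; exact hz4 _ _ _ _)
        · exact key _ hX _ _ _ _ {b, x₁, y₂, y₃}
            (by simp only [hR, insert_eq_cons, ← singleton_add]; abel)
            (by rw [hβ, ey₁, ex₂, ex₃]; exact hz5 _ _ _ _)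
        · exact key _ hX _ _ _ _ {a, x₁, x₂, x₃}
            (by simp only [hR, insert_eq_cons, ← singleton_add]; abel)
            (by rw [hcb, ey₁, ey₂, ey₃]; exact hz2 _ _ _)

/-- A sequence of length `4 * n + 2` without zero-sum subsequence of length `2 * n` contains
`2 * n - 1` elements with a common double, of at most three values, all but one of them in pairs. -/
theorem exists_replicate_le {t : G} (ht : t + t = 0) (ht0 : t ≠ 0) (hc : card S = 4 * n + 2) :
    ∃ (f f₂ f₃ : G) (u v w : ℕ), u + v + w = n - 1 ∧ f₂ ≠ f ∧ f₃ ≠ f ∧ f₂ + f₂ = f + f ∧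
      f₃ + f₃ = f + f ∧
      replicate (2 * u + 1) f + replicate (2 * v) f₂ + replicate (2 * w) f₃ ≤ S := by
  classical
  obtain ⟨B, R, hSB, hB, hRn⟩ := exists_pairs_add c S
  have h1 := card_blocks_lt he hker hS hB (hSB ▸ le_add_right _ _)
  have h2 : card R ≤ 8 := by
    have : (⟨R.map c, hRn⟩ : Finset (ZMod 2 × ZMod 2 × ZMod 2)).card ≤ 8 := Finset.card_le_univ _
    simpa using this
  have h3 := congrArg card hSB
  rw [card_add, card_join_of_forall fun X hX => (hB X hX).1, hc] at h3
  -- At most 2n - 2 pairs leave at least 6 terms, there are only 8 classes, and the number of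
  -- leftovers is even.
  have h4 : card R = 6 ∨ card R = 8 := by omega
  rcases h4 with h4 | h4
  swap
  · exact (false_of_card_eq_eight hn he hker hS hB (by omega) hSB hRn h4).elim
  obtain ⟨g, h, x₁, y₁, x₂, y₂, x₃, y₃, hgh, hP, hR, e₁, e₂, e₃, hpair⟩ :=
    exists_couples_of_card_eq_six hn he hker hS hB (by omega) hSB hRn h4
  have hRnod := Nodup.of_map c hRn
  have hone : ∀ x y : G, (x + x) + (y + y) = g + h → ¬ (x + x = g ∧ y + y = g) := by
    rintro x y h1 ⟨h2, h3⟩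
    rw [h2, h3] at h1
    exact hgh (add_left_cancel h1)
  -- the pairs with sum `g`
  set Bg := B.filter (fun X => X.sum = g) with hBg
  have hBgc : card Bg = n - 1 := by
    have h5 : count g (B.map sum) = card Bg := by
      rw [count_map, hBg]
      simp only [eq_comm]
    rw [← h5, hP]
    simp [count_replicate, hgh.symm]
  have hBgX : ∀ X ∈ Bg, ∃ r ∈ R, r + r = g ∧ X = {r, r} := by
    intro X hX
    obtain ⟨hX, hs⟩ := mem_filter.1 hX
    obtain ⟨r, hr, rfl⟩ := hpair X hX
    exact ⟨r, hr, by simpa using hs, rfl⟩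
  obtain ⟨X₀, hX₀⟩ := card_pos_iff_exists_mem.1 (by omega : 0 < card Bg)
  obtain ⟨f, hfR, hfg, -⟩ := hBgX X₀ hX₀
  have hthree : ∃ f₂ f₃, f₂ ≠ f ∧ f₃ ≠ f ∧ ∀ r ∈ R, r + r = g → r = f ∨ r = f₂ ∨ r = f₃ := by
    have hline : ∀ x y : G, (x + x) + (y + y) = g + h →
        ∃ z, (z = x ∨ z = y) ∧ ∀ r, r + r = g → r = x ∨ r = y → r = z := by
      intro x y hxy
      by_cases hx : x + x = g
      · refine ⟨x, Or.inl rfl, ?_⟩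
        rintro r hr (rfl | rfl)
        · rfl
        · exact absurd ⟨hx, hr⟩ (hone x r hxy)
      · refine ⟨y, Or.inr rfl, ?_⟩
        rintro r hr (rfl | rfl)
        · exact absurd hr hx
        · rfl
    obtain ⟨z₁, m₁, k₁⟩ := hline x₁ y₁ e₁
    obtain ⟨z₂, m₂, k₂⟩ := hline x₂ y₂ e₂
    obtain ⟨z₃, m₃, k₃⟩ := hline x₃ y₃ e₃
    have hall : ∀ r ∈ R, r + r = g → r = z₁ ∨ r = z₂ ∨ r = z₃ := by
      intro r hr hrg
      rw [hR] at hr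
      simp only [insert_eq_cons, mem_cons, mem_singleton] at hr
      rcases hr with h | h | h | h | h | h
      exacts [Or.inl (k₁ r hrg (Or.inl h)), Or.inl (k₁ r hrg (Or.inr h)),
        Or.inr (Or.inl (k₂ r hrg (Or.inl h))), Or.inr (Or.inl (k₂ r hrg (Or.inr h))),
        Or.inr (Or.inr (k₃ r hrg (Or.inl h))), Or.inr (Or.inr (k₃ r hrg (Or.inr h)))]
    rw [hR] at hRnod
    simp only [insert_eq_cons, nodup_cons, mem_cons, mem_singleton, not_or] at hRnod
    have n₁₂ : z₁ ≠ z₂ := by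
      clear * - m₁ m₂ hRnod
      grind
    have n₁₃ : z₁ ≠ z₃ := by
      clear * - m₁ m₃ hRnod
      grind
    have n₂₃ : z₂ ≠ z₃ := by
      clear * - m₂ m₃ hRnod
      grind
    rcases hall f hfR hfg with rfl | rfl | rfl
    · exact ⟨z₂, z₃, n₁₂.symm, n₁₃.symm, hall⟩
    · refine ⟨z₁, z₃, n₁₂, n₂₃.symm, fun r hr hrg => (hall r hr hrg).elim
        (fun h => Or.inr (Or.inl h)) fun h => h.imp id Or.inr⟩
    · refine ⟨z₁, z₂, n₁₃, n₂₃, fun r hr hrg => (hall r hr hrg).elim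
        (fun h => Or.inr (Or.inl h)) fun h => h.elim (fun h => Or.inr (Or.inr h)) Or.inl⟩
  obtain ⟨f₂, f₃, hf₂, hf₃, hthree⟩ := hthree
  -- A candidate whose double is not g occurs in no pair of sum g. It is replaced by f + t, which
  -- has the right double, so that the difference from f has order two even when the multiplicity is
  -- zero.
  have hrepl : ∀ z, z ≠ f → ∃ z', z' ≠ f ∧ z' + z' = g ∧ ∀ r, r + r = g → r = z → r = z' := by
    intro z hz
    by_cases hzg : z + z = g
    · exact ⟨z, hz, hzg, fun r _ h => h⟩
    · refine ⟨f + t, by simpa using ht0, by rw [add_add_add_comm, hfg, ht, add_zero], ?_⟩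
      rintro r hr rfl
      exact absurd hr hzg
  obtain ⟨z₂, n₂, g₂, r₂⟩ := hrepl f₂ hf₂
  obtain ⟨z₃, n₃, g₃, r₃⟩ := hrepl f₃ hf₃
  obtain ⟨u, v, w, huvw, hjoin⟩ := exists_join_eq_replicate (B := Bg) (f := f) (f₂ := z₂)
    (f₃ := z₃) (by
      intro X hX
      obtain ⟨r, hr, hrg, rfl⟩ := hBgX X hX
      rcases hthree r hr hrg with h | h | h
      · exact Or.inl (by rw [h])
      · exact Or.inr (Or.inl (by rw [r₂ r hrg h]))
      · exact Or.inr (Or.inr (by rw [r₃ r hrg h])))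
  refine ⟨f, z₂, z₃, u, v, w, huvw.trans hBgc, n₂, n₃, by rw [g₂, hfg], by rw [g₃, hfg], ?_⟩
  calc replicate (2 * u + 1) f + replicate (2 * v) z₂ + replicate (2 * w) z₃
      = Bg.join + {f} := by
        rw [hjoin, replicate_succ, ← singleton_add]
        abel
    _ ≤ B.join + R := add_le_add (join_le_join (filter_le _ _)) (singleton_le.2 hfR)
    _ = S := hSB.symm

end

/-! ### Bounds for the constants -/

section Constants

variable {G : Type*} [AddCommGroup G] {L : Set ℕ}

theorem zero_mem_subsums_of_sConst_eq {N : ℕ} (h : (N : ℕ∞) = sConst G L) (S : Multiset G)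
    (hS : N ≤ card S) : (0 : G) ∈ subsums L S := by
  by_contra hcon
  have : ((card S + 1 : ℕ) : ℕ∞) ≤ sConst G L := by
    refine le_iInf₂ fun ℓ hℓ => ?_
    by_contra! hlt
    rw [Nat.cast_lt] at hlt
    exact hcon (hℓ S (by omega))
  rw [← h, Nat.cast_le] at this
  omega

theorem card_add_one_le_sConst {S : Multiset G} (hS : (0 : G) ∉ subsums L S) :
    (card S : ℕ∞) + 1 ≤ sConst G L := by
  refine le_iInf₂ fun ℓ hℓ => ?_
  by_contra! hlt
  have hlt' : ((ℓ : ℕ) : ℕ∞) < ((card S + 1 : ℕ) : ℕ∞) := by simpa using hlt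
  rw [Nat.cast_lt] at hlt'
  exact hS (hℓ S (by omega))

theorem sConst_le {N : ℕ} (h : ∀ S : Multiset G, N ≤ card S → (0 : G) ∈ subsums L S) :
    sConst G L ≤ N :=
  iInf₂_le N h

end Constants

/-! ### Lower bound for s(G) -/

section Example

variable {n : ℕ}

/-- A sequence of length `4 * n + 2` over `C_2 ⊕ C_2 ⊕ C_{2n}`. -/
def extremalExample (n : ℕ) : Multiset (ZMod 2 × ZMod 2 × ZMod (2 * n)) :=
  replicate (2 * n - 1) 0 + replicate (2 * n - 1) (0, 0, 1) + replicate 1 (1, 0, 0) +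
    replicate 1 (1, 0, 1) + replicate 1 (0, 1, 0) + replicate 1 (0, 1, 1)

theorem card_extremalExample (hn : 1 ≤ n) : card (extremalExample n) = 4 * n + 2 := by
  simp only [extremalExample, card_add, card_replicate]
  omega

/-- The first two coordinates force a = b and c = d. The last makes j + b + d zero or 2n; with total
length 2n, this leaves 2n copies of either 0 or (0, 0, 1), one more than available. -/
theorem zeroSumFreeAt_extremalExample (hn : 1 ≤ n) :
    ZeroSumFreeAt (2 * n) (extremalExample n) := by
  intro T hT hc hs
  obtain ⟨U₅, g₅, T₆, h₆, rfl⟩ := exists_add_of_le_add hT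
  obtain ⟨U₄, g₄, T₅, h₅, rfl⟩ := exists_add_of_le_add g₅
  obtain ⟨U₃, g₃, T₄, h₄, rfl⟩ := exists_add_of_le_add g₄
  obtain ⟨U₂, g₂, T₃, h₃, rfl⟩ := exists_add_of_le_add g₃
  obtain ⟨T₁, h₁, T₂, h₂, rfl⟩ := exists_add_of_le_add g₂
  obtain ⟨i, hi, rfl⟩ := le_replicate_iff.1 h₁
  obtain ⟨j, hj, rfl⟩ := le_replicate_iff.1 h₂
  obtain ⟨a, ha, rfl⟩ := le_replicate_iff.1 h₃
  obtain ⟨b, hb, rfl⟩ := le_replicate_iff.1 h₄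
  obtain ⟨c, hc', rfl⟩ := le_replicate_iff.1 h₅
  obtain ⟨d, hd, rfl⟩ := le_replicate_iff.1 h₆
  simp only [card_add, card_replicate] at hc
  simp only [sum_add, sum_replicate, Prod.smul_mk, smul_zero, nsmul_eq_mul, mul_one, Prod.mk_add_mk,
    zero_add, add_zero, Prod.mk_eq_zero] at hs
  obtain ⟨s₁, s₂, s₃⟩ := hs
  have d₁ : 2 ∣ a + b := by rw [← ZMod.natCast_eq_zero_iff]; exact_mod_cast s₁
  have d₂ : 2 ∣ c + d := by rw [← ZMod.natCast_eq_zero_iff]; exact_mod_cast s₂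
  have d₃ : 2 * n ∣ j + b + d := by rw [← ZMod.natCast_eq_zero_iff]; exact_mod_cast s₃
  obtain ⟨k, hk⟩ := d₃
  rcases k with _ | k
  · omega
  · have : 2 * n ≤ 2 * n * (k + 1) := Nat.le_mul_of_pos_right _ (by omega)
    omega

end Example

/-! ### Transfer to G and the translated sequence -/

section Group

variable {G : Type*} [AddCommGroup G] {n : ℕ}

theorem exponent_eq (φ : G ≃+ ZMod 2 × ZMod 2 × ZMod (2 * n)) : AddMonoid.exponent G = 2 * n := by
  rw [AddMonoid.exponent_eq_of_addEquiv φ, AddMonoid.exponent_prod, AddMonoid.exponent_prod,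
    ZMod.exponent, ZMod.exponent]
  simp [GCDMonoid.lcm, Nat.lcm_eq_right]

theorem card_add_one_le_egzConst (hn : 1 ≤ n) (φ : G ≃+ ZMod 2 × ZMod 2 × ZMod (2 * n)) :
    ((4 * n + 3 : ℕ) : ℕ∞) ≤ egzConst G := by
  have hmap : ((extremalExample n).map φ.symm).map φ.toAddMonoidHom = extremalExample n := by
    rw [Multiset.map_map]
    simp
  have hfree : ZeroSumFreeAt (2 * n) ((extremalExample n).map φ.symm) :=
    ZeroSumFreeAt.of_map (φ := φ.toAddMonoidHom) (by
      rw [hmap]; exact zeroSumFreeAt_extremalExample hn)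
  have := card_add_one_le_sConst (L := {AddMonoid.exponent G})
    (S := (extremalExample n).map φ.symm) (by
      rintro ⟨T, hT, -, hc, hs⟩
      exact hfree T hT (hc.trans (exponent_eq φ)) hs)
  rw [card_map, card_extremalExample hn] at this
  exact_mod_cast this

/-- Reduction modulo `2 • G`. -/
def classHom (φ : G ≃+ ZMod 2 × ZMod 2 × ZMod (2 * n)) : G →+ ZMod 2 × ZMod 2 × ZMod 2 :=
  ((AddMonoidHom.id (ZMod 2)).prodMap ((AddMonoidHom.id (ZMod 2)).prodMap
    (ZMod.castHom (dvd_mul_right 2 n) (ZMod 2)).toAddMonoidHom)).comp φ.toAddMonoidHom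

theorem mem_zmultiples_of_classHom_eq_zero (hn : 1 ≤ n)
    (φ : G ≃+ ZMod 2 × ZMod 2 × ZMod (2 * n)) {x : G} (hx : classHom φ x = 0) :
    x ∈ AddSubgroup.zmultiples (φ.symm (0, 0, 2)) := by
  have : NeZero (2 * n) := ⟨by omega⟩
  obtain ⟨⟨a, b, z⟩, rfl⟩ := φ.symm.surjective x
  simp only [classHom, AddMonoidHom.coe_comp, Function.comp_apply, AddEquiv.toAddMonoidHom_eq_coe,
    AddMonoidHom.coe_coe,
    AddEquiv.apply_symm_apply, AddMonoidHom.prodMap_def, AddMonoidHom.prod_apply,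
    AddMonoidHom.coe_fst, AddMonoidHom.coe_snd, AddMonoidHom.id_apply, Prod.mk_eq_zero] at hx
  obtain ⟨rfl, rfl, hz⟩ := hx
  rw [← ZMod.natCast_zmod_val z] at hz ⊢
  have hz' : ((z.val : ℕ) : ZMod 2) = 0 := by simpa using hz
  rw [ZMod.natCast_eq_zero_iff] at hz'
  obtain ⟨k, hk⟩ := hz'
  refine ⟨k, ?_⟩
  change (k : ℤ) • φ.symm (0, 0, 2) = _
  rw [← map_zsmul, hk]
  simp [mul_comm]

theorem addOrderOf_symm_two (hn : 1 ≤ n) (φ : G ≃+ ZMod 2 × ZMod 2 × ZMod (2 * n)) :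
    addOrderOf (φ.symm (0, 0, 2)) = n := by
  rw [AddEquiv.addOrderOf_eq, Prod.addOrderOf_mk, Prod.addOrderOf_mk]
  have := ZMod.addOrderOf_coe 2 (n := 2 * n) (by omega)
  rw [Nat.gcd_mul_right_left, Nat.mul_div_cancel_left n (by omega)] at this
  simp only [addOrderOf_zero, Nat.lcm_one_left]
  exact_mod_cast this

theorem exists_replicate_le_of_card (hn : 2 ≤ n) (φ : G ≃+ ZMod 2 × ZMod 2 × ZMod (2 * n))
    {S : Multiset G} (hc : 4 * n + 2 ≤ card S) (hS : ZeroSumFreeAt (2 * n) S) :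
    ∃ (f f₂ f₃ : G) (u v w : ℕ), u + v + w = n - 1 ∧ f₂ ≠ f ∧ f₃ ≠ f ∧ f₂ + f₂ = f + f ∧
      f₃ + f₃ = f + f ∧
      replicate (2 * u + 1) f + replicate (2 * v) f₂ + replicate (2 * w) f₃ ≤ S := by
  obtain ⟨S', hS', hc'⟩ := exists_le_card S hc
  obtain ⟨f, f₂, f₃, u, v, w, h1, h2, h3, h4, h5, h6⟩ := exists_replicate_le hn
    (addOrderOf_symm_two (by omega) φ)
    (fun x hx => mem_zmultiples_of_classHom_eq_zero (by omega) φ hx) (hS.mono hS')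
    (t := φ.symm (1, 0, 0)) (by rw [← _root_.map_add, AddEquiv.map_eq_zero_iff]; simp; decide)
    (by rw [Ne, AddEquiv.map_eq_zero_iff]; simp) hc'
  exact ⟨f, f₂, f₃, u, v, w, h1, h2, h3, h4, h5, h6.trans hS'⟩

theorem addOrderOf_sub_eq_two {f g : G} (h : g ≠ f) (h2 : g + g = f + f) :
    addOrderOf (-f + g) = 2 := by
  refine addOrderOf_eq_prime ?_ ?_
  · rw [two_nsmul, add_add_add_comm, h2]
    abel
  · rwa [Ne, neg_add_eq_zero, eq_comm]

/-- Sequences `0 ^ (2 * u + 1) f₁ ^ (2 * v) f₂ ^ (2 * w)` with `f₁`, `f₂` of order two contain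
zero-sum subsequences of all lengths up to `2 * (u + v + w) + 1`. -/
theorem exists_zeroSum_of_le {f₁ f₂ : G} (h₁ : addOrderOf f₁ = 2) (h₂ : addOrderOf f₂ = 2)
    {u v w k : ℕ} (hk : k ≤ 2 * (u + v + w) + 1) :
    ∃ T ≤ replicate (2 * u + 1) 0 + replicate (2 * v) f₁ + replicate (2 * w) f₂,
      card T = k ∧ T.sum = 0 := by
  obtain ⟨a, b, c, ha, hb, hc, rfl⟩ : ∃ a b c, a ≤ 2 * u + 1 ∧ b ≤ v ∧ c ≤ w ∧
      k = a + 2 * b + 2 * c := by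
    by_cases hv : k / 2 ≤ v
    · exact ⟨k % 2, k / 2, 0, by omega, hv, by omega, by omega⟩
    · by_cases hw : k / 2 ≤ v + w
      · exact ⟨k % 2, v, k / 2 - v, by omega, le_rfl, by omega, by omega⟩
      · exact ⟨k - 2 * v - 2 * w, v, w, by omega, le_rfl, le_rfl, by omega⟩
  refine ⟨replicate a 0 + replicate (2 * b) f₁ + replicate (2 * c) f₂, ?_, by simp, ?_⟩
  · exact add_le_add (add_le_add ((replicate_le_replicate _).2 ha)
      ((replicate_le_replicate _).2 (by omega))) ((replicate_le_replicate _).2 (by omega))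
  · have z₁ : 2 • f₁ = 0 := h₁ ▸ addOrderOf_nsmul_eq_zero f₁
    have z₂ : 2 • f₂ = 0 := h₂ ▸ addOrderOf_nsmul_eq_zero f₂
    simp [mul_nsmul, z₁, z₂]

end Group

end ZeroSum

/-! ### Main theorem -/

theorem mainTheorem4 {G : Type*} [AddCommGroup G] (n : ℕ) (hn : 2 ≤ n)
    (hG : Nonempty (G ≃+ ZMod 2 × ZMod 2 × ZMod (2 * n)))
    (S : Multiset G)
    (hcard : (Multiset.card S : ℕ∞) + 1 = ZeroSum.egzConst G)
    (hS : ¬ ZeroSum.HasZeroSumSubsequenceOfLengthExp S) :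
    ∃ (f : G) (C T : Multiset G),
      ZeroSum.translate (-f) S = C + T ∧
      (Multiset.card T : ℕ∞) + 1 = ZeroSum.etaConst G ∧
      ¬ ZeroSum.HasShortZeroSumSubsequence T ∧
      Multiset.card C + 1 = AddMonoid.exponent G ∧
      ∃ (u v w : ℕ) (f₁ f₂ : G), addOrderOf f₁ = 2 ∧ addOrderOf f₂ = 2 ∧
        C = Multiset.replicate (2 * u + 1) 0 + Multiset.replicate (2 * v) f₁ +
          Multiset.replicate (2 * w) f₂ := by
  obtain ⟨φ⟩ := hG
  have hexp := ZeroSum.exponent_eq φ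
  have hfree : ZeroSum.ZeroSumFreeAt (2 * n) S :=
    fun T hT hc hs => hS ⟨T, hT, hc.trans hexp.symm, hs⟩
  have hlen : 4 * n + 2 ≤ Multiset.card S := by
    have := ZeroSum.card_add_one_le_egzConst (by omega) φ
    rw [← hcard] at this
    have h : 4 * n + 3 ≤ Multiset.card S + 1 := by exact_mod_cast this
    omega
  obtain ⟨f, f₂, f₃, u, v, w, huvw, n₂, n₃, e₂, e₃, hle⟩ :=
    ZeroSum.exists_replicate_le_of_card hn φ hlen hfree
  obtain ⟨T', hT'⟩ := Multiset.le_iff_exists_add.1 hle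
  have o₂ := ZeroSum.addOrderOf_sub_eq_two n₂ e₂
  have o₃ := ZeroSum.addOrderOf_sub_eq_two n₃ e₃
  set C := Multiset.replicate (2 * u + 1) (0 : G) + Multiset.replicate (2 * v) (-f + f₂) +
    Multiset.replicate (2 * w) (-f + f₃) with hC
  have hCc : Multiset.card C + 1 = 2 * n := by
    simp only [hC, Multiset.card_add, Multiset.card_replicate]
    omega
  have htrans : ZeroSum.translate (-f) S = C + T'.map (fun g => -f + g) := by
    rw [ZeroSum.translate, hT', Multiset.map_add, hC]
    simp
  have hTfree : ¬ ZeroSum.HasShortZeroSumSubsequence (T'.map fun g => -f + g) := by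
    rintro ⟨U, hU, hU0, hUc, hUs⟩
    rw [hexp] at hUc
    have hUpos := Multiset.card_pos.2 hU0
    -- `C` supplies a zero-sum complement of exactly the missing length. Undoing the translation on
    -- 2n terms changes the sum by 2n • f = 0.
    obtain ⟨W, hW, hWc, hWs⟩ := ZeroSum.exists_zeroSum_of_le o₂ o₃ (u := u) (v := v) (w := w)
      (k := 2 * n - Multiset.card U) (by omega)
    obtain ⟨X, hX, hXeq⟩ := ZeroSum.exists_le_map_eq (fun g => -f + g) S (t := W + U)
      (by
        change _ ≤ ZeroSum.translate (-f) S
        rw [htrans]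
        exact add_le_add hW hU)
    have hXc : Multiset.card X = 2 * n := by
      have := congrArg Multiset.card hXeq
      rw [Multiset.card_map, Multiset.card_add, hWc] at this
      omega
    refine hfree X hX hXc ?_
    have hsum := congrArg Multiset.sum hXeq
    have hφ : (2 * n) • f = 0 := by
      rw [← hexp]
      exact AddMonoid.exponent_nsmul_eq_zero f
    rw [Multiset.sum_add, hWs, hUs, Multiset.sum_map_add, Multiset.map_const', Multiset.map_id',
      Multiset.sum_replicate, hXc, smul_neg, hφ] at hsum
    simpa using hsum
  refine ⟨f, C, T'.map (fun g => -f + g), htrans, ?_, hTfree, hCc.trans hexp.symm, u, v, w,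
    -f + f₂, -f + f₃, o₂, o₃, rfl⟩
  have hTc : Multiset.card (T'.map fun g => -f + g) + 2 * n = Multiset.card S + 1 := by
    have := congrArg Multiset.card htrans
    rw [ZeroSum.translate, Multiset.card_map, Multiset.card_add] at this
    omega
  refine le_antisymm (ZeroSum.card_add_one_le_sConst ?_) ?_
  · rintro ⟨U, hU, hU0, hUc, hUs⟩
    exact hTfree ⟨U, hU, hU0, hUc.2, hUs⟩
  -- Adjoin 2n - 1 zeros to U, reaching length s(G). A zero-sum subsequence of length 2n cannot
  -- consist of these zeros alone, and its part in U is short.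
  · have hle : ZeroSum.etaConst G ≤
        ((Multiset.card (T'.map fun g => -f + g) + 1 : ℕ) : ℕ∞) := by
      refine ZeroSum.sConst_le fun U hU => ?_
      obtain ⟨X, hX, -, hXc, hXs⟩ := ZeroSum.zero_mem_subsums_of_sConst_eq
        (N := Multiset.card S + 1) (by exact_mod_cast hcard)
        (Multiset.replicate (2 * n - 1) 0 + U)
        (by rw [Multiset.card_add, Multiset.card_replicate]; omega)
      obtain ⟨Z, hZ, U', hU', rfl⟩ := ZeroSum.exists_add_of_le_add hX
      obtain ⟨k, hk, rfl⟩ := Multiset.le_replicate_iff.1 hZ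
      have hXc' : k + Multiset.card U' = 2 * n := by
        rw [Set.mem_singleton_iff, hexp] at hXc
        simpa using hXc
      refine ⟨U', hU', ?_, ⟨?_, ?_⟩, by simpa using hXs⟩
      · rintro rfl
        simp at hXc'
        omega
      · omega
      · omega
    exact_mod_cast hle
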